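/- A \emph{$*$-ternary ring} is a complex vector space $E$ with a map $\mu:E^3\to E$, linear in the first and third variables, conjugate linear in the second, with $\mu(\mu(x,y,z),u,v)=\mu(x,\mu(u,z,y),v)=\mu(x,y,\mu(z,u,v))$. A \emph{$C^*$-norm} on it is a norm with $\|\mu(x,y,z)\|\le\|x\|\|y\|\|z\|$ and $\|\mu(x,x,x)\|=\|x\|^3$; if $E$ is complete for such a norm, $E$ is a \emph{$C^*$-ternary ring}. The \emph{right associated pair} of a $C^*$-ternary ring $E$ is the (up to canonical isomorphism unique) pair $(B_E,\langle\cdot,\cdot\rangle)$ of a $C^*$-algebra $B_E$, over which $E$ is a right Banach module, and a sesquilinear map $\langle\cdot,\cdot\rangle:E\times E\to B_E$, conjugate linear in the first variable, with $\|\langle x,y\rangle\|\le\|x\|\|y\|$, $\langle x,yb\rangle=\langle x,y\rangle b$, $\langle x,y\rangle^*=\langle y,x\rangle$, $\mu(x,y,z)=x\langle y,z\rangle$, and $\operatorname{span}\langle E,E\rangle$ dense in $B_E$; $E$ is \emph{positive} if $\langle x,x\rangle\ge 0$ in $B_E$ for all $x\in E$. Let $E$ and $F$ be positive $C^*$-ternary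 rings with ternary products $\mu,\nu$ and right associated pairs $(B_E,\langle\cdot,\cdot\rangle_E)$, $(B_F,\langle\cdot,\cdot\rangle_F)$. Let $E\odot F$ be the algebraic tensor product with the $*$-ternary product $\mu\odot\nu$ determined by $(e\odot f,e'\odot f',e''\odot f'')\mapsto\mu(e,e',e'')\odot\nu(f,f',f'')$, and let $\langle\cdot,\cdot\rangle:(E\odot F)^2\to B_E\odot B_F$ be the sesquilinear map with $\langle e\odot f,e'\odot f'\rangle=\langle e,e'\rangle_E\odot\langle f,f'\rangle_F$. Let $\mathcal N_1$ be the set of $C^*$-norms on the $*$-algebra $B_E\odot B_F$ and $\mathcal N_2$ the set of $C^*$-norms on the $*$-ternary ring $E\odot F$, both with the pointwise order. Then: (1) for every $\gamma\in\mathcal N_1$, the formula $\tilde\gamma(x)=\sqrt{\gamma(\langle x,x\rangle)}$ defines an element $\tilde\gamma\in\mathcal N_2$; (2) for every $\alpha\in\mathcal N_2$ there is exactly one $\overline\alpha\in\mathcal N_1$ such that the right associated $C^*$-algebra of the completion $E\otimes_\alpha F$ is the completion $B_E\otimes_{\overline\alpha}B_F$, that is, such that there is a $*$-homomorphism $j$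 from $B_E\odot B_F$ onto a dense subalgebra of $B_{E\otimes_\alpha F}$ with $\|j(t)\|=\overline\alpha(t)$ for all $t$ and $j(\langle e,e'\rangle_E\odot\langle f,f'\rangle_F)=\langle e\odot f,e'\odot f'\rangle_{E\otimes_\alpha F}$ for all $e,e'\in E$, $f,f'\in F$; (3) the maps $\phi:\mathcal N_1\to\mathcal N_2$, $\gamma\mapsto\tilde\gamma$, and $\psi:\mathcal N_2\to\mathcal N_1$, $\alpha\mapsto\overline\alpha$, are mutually inverse, order-preserving bijections. -/

import Mathlib

open scoped TensorProduct ComplexConjugate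

noncomputable section

/-! ## `*`-ternary rings and `C*`-ternary rings -/

/-- A `*`-ternary ring: a complex vector space with a ternary product `μ (x, y, z)`, linear in the
odd variables, conjugate linear in the second one, and associative in the sense
`μ (μ (x, y, z), u, v) = μ (x, μ (u, z, y), v) = μ (x, y, μ (z, u, v))`. -/
class StarTernaryRing (E : Type*) [AddCommGroup E] [Module ℂ E] where
  /-- the ternary product -/
  tern : E →ₗ[ℂ] E →ₗ⋆[ℂ] E →ₗ[ℂ] E
  tern_tern_left : ∀ x y z u v : E, tern (tern x y z) u v = tern x (tern u z y) v
  tern_tern_right : ∀ x y z u v : E, tern x (tern u z y) v = tern x y (tern z u v)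

/-- A `C*`-ternary ring: a Banach space with a `*`-ternary product such that
`‖μ (x, y, z)‖ ≤ ‖x‖ ‖y‖ ‖z‖` and `‖μ (x, x, x)‖ = ‖x‖ ^ 3`. -/
class CStarTernaryRing (E : Type*) [NormedAddCommGroup E] [NormedSpace ℂ E] extends
    StarTernaryRing E, CompleteSpace E where
  norm_tern_le : ∀ x y z : E, ‖tern x y z‖ ≤ ‖x‖ * ‖y‖ * ‖z‖
  norm_tern_self : ∀ x : E, ‖tern x x x‖ = ‖x‖ ^ 3

open StarTernaryRing

/-! ## `C*`-norms -/

/-- A `C*`-norm on a complex `*`-algebra. -/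
structure CStarNorm (A : Type*) [NonUnitalRing A] [Module ℂ A] [Star A] extends
    Seminorm ℂ A where
  eq_zero_of_map_eq_zero : ∀ a : A, toFun a = 0 → a = 0
  map_mul_le : ∀ a b : A, toFun (a * b) ≤ toFun a * toFun b
  map_star_mul_self : ∀ a : A, toFun (star a * a) = toFun a ^ 2

namespace CStarNorm

variable {A : Type*} [NonUnitalRing A] [Module ℂ A] [Star A]

instance : CoeFun (CStarNorm A) fun _ => A → ℝ := ⟨fun γ => γ.toFun⟩

theorem coe_injective : Function.Injective fun (γ : CStarNorm A) (a : A) => γ a := by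
  rintro ⟨γ, _, _, _⟩ ⟨δ, _, _, _⟩ h
  have : γ = δ := DFunLike.ext _ _ fun a => congrFun h a
  subst this
  rfl

/-- The usual (pointwise) order of norms. -/
instance : PartialOrder (CStarNorm A) :=
  PartialOrder.lift (fun (γ : CStarNorm A) (a : A) => γ a) coe_injective

end CStarNorm

/-- A `C*`-norm on a `*`-ternary ring. -/
structure TernaryCStarNorm (V : Type*) [AddCommGroup V] [Module ℂ V] [StarTernaryRing V] extends
    Seminorm ℂ V where
  eq_zero_of_map_eq_zero : ∀ x : V, toFun x = 0 → x = 0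
  map_tern_le : ∀ x y z : V, toFun (tern x y z) ≤ toFun x * toFun y * toFun z
  map_tern_self : ∀ x : V, toFun (tern x x x) = toFun x ^ 3

namespace TernaryCStarNorm

variable {V : Type*} [AddCommGroup V] [Module ℂ V] [StarTernaryRing V]

instance : CoeFun (TernaryCStarNorm V) fun _ => V → ℝ := ⟨fun α => α.toFun⟩

theorem coe_injective : Function.Injective fun (α : TernaryCStarNorm V) (x : V) => α x := by
  rintro ⟨γ, _, _, _⟩ ⟨δ, _, _, _⟩ h
  have : γ = δ := DFunLike.ext _ _ fun a => congrFun h a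
  subst this
  rfl

/-- The usual (pointwise) order of norms. -/
instance : PartialOrder (TernaryCStarNorm V) :=
  PartialOrder.lift (fun (α : TernaryCStarNorm V) (x : V) => α x) coe_injective

/-! ### The completion of a `*`-ternary ring with respect to a `C*`-norm -/

/-- The space `V`, normed by the `C*`-norm `α`. -/
def Carrier (_α : TernaryCStarNorm V) : Type _ := V

variable (α : TernaryCStarNorm V)

instance : NormedAddCommGroup α.Carrier :=
  AddGroupNorm.toNormedAddCommGroup (E := V)
    { toFun := fun x : V => α x
      map_zero' := map_zero α.toSeminorm
      add_le' := map_add_le_add α.toSeminorm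
      neg' := map_neg_eq_map α.toSeminorm
      eq_zero_of_map_eq_zero' := α.eq_zero_of_map_eq_zero }

instance : NormedSpace ℂ α.Carrier where
  toModule := inferInstanceAs (Module ℂ V)
  norm_smul_le c x := (map_smul_eq_mul α.toSeminorm c (x : V)).le

instance : StarTernaryRing α.Carrier := inferInstanceAs (StarTernaryRing V)

/-- The completion of `V` with respect to the `C*`-norm `α`. -/
def Completion : Type _ := UniformSpace.Completion α.Carrier

instance : NormedAddCommGroup α.Completion :=
  inferInstanceAs (NormedAddCommGroup (UniformSpace.Completion α.Carrier))

instance : NormedSpace ℂ α.Completion :=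
  inferInstanceAs (NormedSpace ℂ (UniformSpace.Completion α.Carrier))

instance : CompleteSpace α.Completion :=
  inferInstanceAs (CompleteSpace (UniformSpace.Completion α.Carrier))

/-- The canonical inclusion of the normed space `(V, α)` into its completion. -/
def incl : α.Carrier →ₗᵢ[ℂ] α.Completion :=
  UniformSpace.Completion.toComplₗᵢ (𝕜 := ℂ) (E := α.Carrier)

theorem denseRange_incl : DenseRange α.incl :=
  UniformSpace.Completion.denseRange_coe (α := α.Carrier)

/-- The canonical inclusion of the vector space `V` into its completion. -/
def toCompletion : V →ₗ[ℂ] α.Completion := α.incl.toLinearMap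

end TernaryCStarNorm

/-- Extension of continuous semilinear maps along an isometry `e` with dense range. -/
def extendAlong (σ : ℂ →+* ℂ) [RingHomIsometric σ] {X Y : Type*} (Z : Type*)
    [NormedAddCommGroup X] [NormedSpace ℂ X] [NormedAddCommGroup Y] [NormedSpace ℂ Y]
    [NormedAddCommGroup Z] [NormedSpace ℂ Z] [CompleteSpace Z] (e : X →ₗᵢ[ℂ] Y)
    (hd : DenseRange e) : (X →SL[σ] Z) →L[ℂ] (Y →SL[σ] Z) :=
  have hd' : DenseRange e.toContinuousLinearMap := hd
  have hu : IsUniformInducing e.toContinuousLinearMap := e.isometry.isUniformInducing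
  LinearMap.mkContinuous
    { toFun := fun f => f.extend e.toContinuousLinearMap
      map_add' := fun f g => by
        refine ContinuousLinearMap.extend_unique _ hd' hu _ ?_
        ext x
        simp only [ContinuousLinearMap.comp_apply, add_apply]
        rw [ContinuousLinearMap.extend_eq _ hd' hu, ContinuousLinearMap.extend_eq _ hd' hu]
      map_smul' := fun c f => by
        refine ContinuousLinearMap.extend_unique _ hd' hu _ ?_
        ext x
        simp only [ContinuousLinearMap.comp_apply, smul_apply, RingHom.id_apply]
        rw [ContinuousLinearMap.extend_eq _ hd' hu] } 1
    (fun f => ContinuousLinearMap.opNorm_extend_le (N := 1) f hd' (fun x => by simp))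

section

variable (σ : ℂ →+* ℂ) [RingHomIsometric σ] {X Y : Type*} (Z : Type*)
  [NormedAddCommGroup X] [NormedSpace ℂ X] [NormedAddCommGroup Y] [NormedSpace ℂ Y]
  [NormedAddCommGroup Z] [NormedSpace ℂ Z] [CompleteSpace Z] (e : X →ₗᵢ[ℂ] Y) (hd : DenseRange e)

theorem extendAlong_apply (f : X →SL[σ] Z) (x : X) : extendAlong σ Z e hd f (e x) = f x :=
  ContinuousLinearMap.extend_eq f (e := e.toContinuousLinearMap) hd
    e.isometry.isUniformInducing x

theorem norm_extendAlong_le (f : X →SL[σ] Z) : ‖extendAlong σ Z e hd f‖ ≤ ‖f‖ := by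
  have := ContinuousLinearMap.opNorm_extend_le (N := 1) f (e := e.toContinuousLinearMap) hd
    (fun x => by simp)
  rw [NNReal.coe_one, one_mul] at this
  exact this

end

namespace TernaryCStarNorm

variable {V : Type*} [AddCommGroup V] [Module ℂ V] [StarTernaryRing V] (α : TernaryCStarNorm V)

theorem norm_tern_carrier_le (x y z : α.Carrier) : ‖tern x y z‖ ≤ ‖x‖ * ‖y‖ * ‖z‖ :=
  α.map_tern_le x y z

theorem completion_induction {p : α.Completion → Prop} (x : α.Completion)
    (hp : IsClosed {x | p x}) (ih : ∀ v : α.Carrier, p (α.incl v)) : p x :=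
  α.denseRange_incl.induction_on x hp ih

/-- The ternary product `V × V × V → V`, extended to `V × V × Completion → Completion`. -/
def ternAux₁ (x y : α.Carrier) : α.Completion →L[ℂ] α.Completion :=
  extendAlong (RingHom.id ℂ) α.Completion α.incl α.denseRange_incl
    (LinearMap.mkContinuous (α.incl.toLinearMap ∘ₗ tern x y) (‖x‖ * ‖y‖) (fun z => by
      change ‖α.incl (tern x y z)‖ ≤ _
      rw [LinearIsometry.norm_map]
      exact α.norm_tern_carrier_le x y z))

theorem ternAux₁_incl (x y z : α.Carrier) :
    α.ternAux₁ x y (α.incl z) = α.incl (tern x y z) :=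
  extendAlong_apply _ _ _ _ _ _

theorem norm_ternAux₁_le (x y : α.Carrier) : ‖α.ternAux₁ x y‖ ≤ 1 * ‖x‖ * ‖y‖ := by
  rw [one_mul]
  exact (norm_extendAlong_le _ _ _ _ _).trans
    (LinearMap.mkContinuous_norm_le _ (by positivity) _)

theorem ext_completion {f g : α.Completion →L[ℂ] α.Completion}
    (h : ∀ z : α.Carrier, f (α.incl z) = g (α.incl z)) : f = g := by
  ext z
  exact α.completion_induction z (isClosed_eq f.continuous g.continuous) h

/-- The ternary product on `V`, extended to `V × V × Completion → Completion`, as a bounded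
sesquilinear map. -/
def ternAux₂ : α.Carrier →L[ℂ] α.Carrier →L⋆[ℂ] (α.Completion →L[ℂ] α.Completion) :=
  LinearMap.mkContinuous₂
    (LinearMap.mk₂'ₛₗ (RingHom.id ℂ) (starRingEnd ℂ) α.ternAux₁
      (fun x x' y => α.ext_completion fun z => by simp [ternAux₁_incl])
      (fun c x y => α.ext_completion fun z => by simp [ternAux₁_incl])
      (fun x y y' => α.ext_completion fun z => by simp [ternAux₁_incl])
      (fun c x y => α.ext_completion fun z => by simp [ternAux₁_incl]))
    1 α.norm_ternAux₁_le

/-- The continuous extension of the ternary product to the completion. -/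
def ternCompletion :
    α.Completion →L[ℂ] α.Completion →L⋆[ℂ] (α.Completion →L[ℂ] α.Completion) :=
  extendAlong (RingHom.id ℂ) _ α.incl α.denseRange_incl
    ((extendAlong (starRingEnd ℂ) (α.Completion →L[ℂ] α.Completion) α.incl
      α.denseRange_incl).comp α.ternAux₂)

theorem ternCompletion_incl (x y z : α.Carrier) :
    α.ternCompletion (α.incl x) (α.incl y) (α.incl z) = α.incl (tern x y z) := by
  rw [ternCompletion, extendAlong_apply, ContinuousLinearMap.comp_apply, extendAlong_apply]
  exact α.ternAux₁_incl x y z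

set_option maxSynthPendingDepth 3 in
@[fun_prop]
theorem continuous_ternCompletion {X : Type*} [TopologicalSpace X] {f g h : X → α.Completion}
    (hf : Continuous f) (hg : Continuous g) (hh : Continuous h) :
    Continuous fun p => α.ternCompletion (f p) (g p) (h p) := by
  have hb : IsBoundedBilinearMap ℝ
      fun p : α.Completion × α.Completion => α.ternCompletion p.1 p.2 :=
    { add_left := fun x x' y => by simp
      smul_left := fun c x y => by
        rw [← Complex.coe_smul c x, ← Complex.coe_smul c, map_smul, smul_apply]
      add_right := fun x y y' => by simp
      smul_right := fun c x y => by
        rw [← Complex.coe_smul c y, ← Complex.coe_smul c, map_smulₛₗ, Complex.conj_ofReal]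
      bound := ⟨‖α.ternCompletion‖ + 1, by positivity, fun x y =>
        ((α.ternCompletion x).le_of_opNorm_le (α.ternCompletion.le_opNorm x) y).trans (by
          gcongr
          linarith)⟩ }
  have h₁ : Continuous fun p => α.ternCompletion (f p) (g p) :=
    hb.continuous.comp (hf.prodMk hg)
  exact h₁.clm_apply hh

/-- The completion of a `*`-ternary ring with respect to a `C*`-norm is a `C*`-ternary ring. -/
instance : CStarTernaryRing α.Completion where
  tern := LinearMap.mk₂'ₛₗ (RingHom.id ℂ) (starRingEnd ℂ)
    (fun x y => (α.ternCompletion x y).toLinearMap)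
    (fun x x' y => by ext; simp) (fun c x y => by ext; simp)
    (fun x y y' => by ext; simp) (fun c x y => by ext; simp)
  tern_tern_left x y z u v := by
    change α.ternCompletion (α.ternCompletion x y z) u v =
      α.ternCompletion x (α.ternCompletion u z y) v
    apply α.completion_induction x
    · apply isClosed_eq <;> fun_prop
    intro x
    apply α.completion_induction y
    · apply isClosed_eq <;> fun_prop
    intro y
    apply α.completion_induction z
    · apply isClosed_eq <;> fun_prop
    intro z
    apply α.completion_induction u
    · apply isClosed_eq <;> fun_prop
    intro u
    apply α.completion_induction v
    · apply isClosed_eq <;> fun_prop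
    intro v
    simp only [ternCompletion_incl, tern_tern_left]
  tern_tern_right x y z u v := by
    change α.ternCompletion x (α.ternCompletion u z y) v =
      α.ternCompletion x y (α.ternCompletion z u v)
    apply α.completion_induction x
    · apply isClosed_eq <;> fun_prop
    intro x
    apply α.completion_induction y
    · apply isClosed_eq <;> fun_prop
    intro y
    apply α.completion_induction z
    · apply isClosed_eq <;> fun_prop
    intro z
    apply α.completion_induction u
    · apply isClosed_eq <;> fun_prop
    intro u
    apply α.completion_induction v
    · apply isClosed_eq <;> fun_prop
    intro v
    simp only [ternCompletion_incl, tern_tern_right]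
  norm_tern_le x y z := by
    change ‖α.ternCompletion x y z‖ ≤ _
    apply α.completion_induction x
    · apply isClosed_le <;> fun_prop
    intro x
    apply α.completion_induction y
    · apply isClosed_le <;> fun_prop
    intro y
    apply α.completion_induction z
    · apply isClosed_le <;> fun_prop
    intro z
    rw [ternCompletion_incl]
    simp only [LinearIsometry.norm_map]
    exact α.norm_tern_carrier_le x y z
  norm_tern_self x := by
    change ‖α.ternCompletion x x x‖ = _
    apply α.completion_induction x
    · apply isClosed_eq <;> fun_prop
    intro x
    rw [ternCompletion_incl]
    simp only [LinearIsometry.norm_map]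
    exact α.map_tern_self x

/-- The ternary product of the completion extends the one of `V`. -/
theorem tern_toCompletion (x y z : V) :
    tern (α.toCompletion x) (α.toCompletion y) (α.toCompletion z) = α.toCompletion (tern x y z) :=
  α.ternCompletion_incl x y z

theorem norm_toCompletion (x : V) : ‖α.toCompletion x‖ = α x :=
  α.incl.norm_map x

end TernaryCStarNorm

/-! ## The right associated pair -/

/-- A right associated pair `(B, ⟨·,·⟩)` of a `C*`-ternary ring `E`: `B` is a `C*`-algebra, `E` is a
right Banach `B`-module (`act x b` stands for `x b`), and the `B`-valued contractive sesquilinear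
map `⟨·,·⟩` on `E`, conjugate linear in the first variable, satisfies `⟨x, y b⟩ = ⟨x, y⟩ b`,
`⟨x, y⟩* = ⟨y, x⟩` and `μ (x, y, z) = x ⟨y, z⟩`, and has a range with dense linear span. -/
structure RightAssociatedPair (E : Type*) [NormedAddCommGroup E] [NormedSpace ℂ E]
    [CStarTernaryRing E] (B : Type*) [NonUnitalCStarAlgebra B] where
  act : E →ₗ[ℂ] B →ₗ[ℂ] E
  act_mul : ∀ x b c, act x (b * c) = act (act x b) c
  norm_act_le : ∀ x b, ‖act x b‖ ≤ ‖x‖ * ‖b‖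
  inner : E →ₗ⋆[ℂ] E →ₗ[ℂ] B
  norm_inner_le : ∀ x y, ‖inner x y‖ ≤ ‖x‖ * ‖y‖
  inner_act : ∀ x y b, inner x (act y b) = inner x y * b
  star_inner : ∀ x y, star (inner x y) = inner y x
  tern_eq_act : ∀ x y z, tern x y z = act x (inner y z)
  dense_span : Dense (Submodule.span ℂ {b | ∃ x y, b = inner x y} : Set B)

/-- `E` is positive (`E = E⁺`): `⟨x, x⟩` is a positive element of `B`, for all `x`. -/
def RightAssociatedPair.IsPositive {E : Type*} [NormedAddCommGroup E] [NormedSpace ℂ E]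
    [CStarTernaryRing E] {B : Type*} [NonUnitalCStarAlgebra B] (p : RightAssociatedPair E B) :
    Prop :=
  ∀ x, ∃ b, p.inner x x = star b * b

/-! ### Construction of the right associated pair of a `C*`-ternary ring -/

namespace CStarTernaryRing

section

variable {E : Type*} [NormedAddCommGroup E] [NormedSpace ℂ E] [CStarTernaryRing E]

/-- `S` is adjoint to `T` with respect to the ternary product, on both sides. -/
def IsAdjointPair (T S : E →L[ℂ] E) : Prop :=
  (∀ z x y, tern z (T x) y = tern (S z) x y) ∧ ∀ z x y, tern z (S x) y = tern (T z) x y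

theorem eq_zero_of_tern {x : E} (h : tern x x x = 0) : x = 0 := by
  have := norm_tern_self x
  rw [h, norm_zero] at this
  exact norm_eq_zero.1 (pow_eq_zero_iff (by norm_num) |>.1 this.symm)

theorem eq_of_tern {x x' : E} (h : ∀ y z, tern x y z = tern x' y z) : x = x' := by
  rw [← sub_eq_zero]
  refine eq_zero_of_tern ?_
  rw [(tern (E := E)).map_sub x x', LinearMap.sub_apply, LinearMap.sub_apply, sub_eq_zero]
  exact h _ _

theorem continuous_tern_middle (z y : E) : Continuous fun x : E => tern z x y :=
  AddMonoidHomClass.continuous_of_bound ((tern z).flip y) (‖z‖ * ‖y‖) fun x =>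
    (norm_tern_le z x y).trans_eq (by ring)

theorem continuous_tern_left (x y : E) : Continuous fun z : E => tern z x y :=
  AddMonoidHomClass.continuous_of_bound ((tern.flip x).flip y) (‖x‖ * ‖y‖) fun z =>
    (norm_tern_le z x y).trans_eq (by ring)

theorem IsAdjointPair.symm {T S : E →L[ℂ] E} (h : IsAdjointPair T S) : IsAdjointPair S T :=
  ⟨h.2, h.1⟩

theorem IsAdjointPair.unique {T S S' : E →L[ℂ] E} (h : IsAdjointPair T S)
    (h' : IsAdjointPair T S') : S = S' := by
  ext z
  exact eq_of_tern fun x y => by rw [← h.1, ← h'.1]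

theorem IsAdjointPair.add {T S T' S' : E →L[ℂ] E} (h : IsAdjointPair T S)
    (h' : IsAdjointPair T' S') : IsAdjointPair (T + T') (S + S') :=
  ⟨fun z x y => by simp [h.1, h'.1], fun z x y => by simp [h.2, h'.2]⟩

theorem IsAdjointPair.smul {T S : E →L[ℂ] E} (h : IsAdjointPair T S) (c : ℂ) :
    IsAdjointPair (c • T) (conj c • S) :=
  ⟨fun z x y => by simp [h.1], fun z x y => by simp [h.2]⟩

theorem IsAdjointPair.comp {T S T' S' : E →L[ℂ] E} (h : IsAdjointPair T S)
    (h' : IsAdjointPair T' S') : IsAdjointPair (T * T') (S' * S) :=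
  ⟨fun z x y => by simp [h.1, h'.1], fun z x y => by simp [h.2, h'.2]⟩

theorem IsAdjointPair.one : IsAdjointPair (1 : E →L[ℂ] E) 1 :=
  ⟨fun _ _ _ => rfl, fun _ _ _ => rfl⟩

theorem IsAdjointPair.norm_sq_le {T S : E →L[ℂ] E} (h : IsAdjointPair T S) :
    ‖T‖ * ‖T‖ ≤ ‖S * T‖ := by
  have key : ∀ x, ‖T x‖ ^ 2 ≤ ‖S * T‖ * ‖x‖ ^ 2 := fun x => by
    rcases eq_or_ne (T x) 0 with h0 | h0
    · rw [h0, norm_zero]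
      simp only [ne_eq, OfNat.ofNat_ne_zero, not_false_eq_true, zero_pow]
      positivity
    · have hpos : 0 < ‖T x‖ := norm_pos_iff.2 h0
      have h1 : ‖T x‖ ^ 3 ≤ ‖S * T‖ * ‖x‖ * ‖x‖ * ‖T x‖ := by
        rw [← norm_tern_self, h.1]
        refine (norm_tern_le _ _ _).trans ?_
        gcongr
        exact (S * T).le_opNorm x
      have h2 : ‖T x‖ ^ 2 * ‖T x‖ ≤ (‖S * T‖ * ‖x‖ ^ 2) * ‖T x‖ := by
        calc _ = ‖T x‖ ^ 3 := by ring
          _ ≤ _ := h1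
          _ = _ := by ring
      exact le_of_mul_le_mul_right h2 hpos
  have hT : ‖T‖ ≤ √‖S * T‖ := by
    refine T.opNorm_le_bound (Real.sqrt_nonneg _) fun x => ?_
    refine le_of_sq_le_sq ?_ (by positivity)
    rw [mul_pow, Real.sq_sqrt (norm_nonneg _)]
    exact key x
  calc ‖T‖ * ‖T‖ ≤ √‖S * T‖ * √‖S * T‖ := by gcongr
    _ = _ := Real.mul_self_sqrt (norm_nonneg _)

theorem IsAdjointPair.norm_le {T S : E →L[ℂ] E} (h : IsAdjointPair T S) : ‖T‖ ≤ ‖S‖ := by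
  rcases eq_or_ne T 0 with rfl | h0
  · simp
  · exact le_of_mul_le_mul_right (h.norm_sq_le.trans (norm_mul_le S T)) (norm_pos_iff.2 h0)

theorem IsAdjointPair.norm_eq {T S : E →L[ℂ] E} (h : IsAdjointPair T S) : ‖S‖ = ‖T‖ :=
  le_antisymm h.symm.norm_le h.norm_le

end

variable (E : Type*) [NormedAddCommGroup E] [NormedSpace ℂ E] [CStarTernaryRing E]

/-- The adjointable operators on `E`, acting on the right: the product is reversed. -/
def adjointable : Subalgebra ℂ (E →L[ℂ] E)ᵐᵒᵖ where
  carrier := {T | ∃ S, IsAdjointPair T.unop S}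
  mul_mem' := by
    rintro T T' ⟨S, h⟩ ⟨S', h'⟩
    exact ⟨S * S', h'.comp h⟩
  add_mem' := by
    rintro T T' ⟨S, h⟩ ⟨S', h'⟩
    exact ⟨S + S', h.add h'⟩
  algebraMap_mem' c := by
    refine ⟨conj c • 1, ?_⟩
    rw [Algebra.algebraMap_eq_smul_one]
    exact IsAdjointPair.one.smul c

variable {E}

/-- The adjoint of an adjointable operator. -/
instance : Star (adjointable E) where
  star T := ⟨MulOpposite.op T.2.choose, T.1.unop, T.2.choose_spec.symm⟩

theorem isAdjointPair_star (T : adjointable E) : IsAdjointPair T.1.unop (star T).1.unop :=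
  T.2.choose_spec

theorem star_eq_of_isAdjointPair {T S : adjointable E} (h : IsAdjointPair T.1.unop S.1.unop) :
    star T = S :=
  Subtype.ext (MulOpposite.unop_injective ((isAdjointPair_star T).unique h))

theorem norm_star_adjointable (T : adjointable E) : ‖star T‖ = ‖T‖ :=
  (isAdjointPair_star T).norm_eq

instance : StarRing (adjointable E) where
  star_involutive T := star_eq_of_isAdjointPair (isAdjointPair_star T).symm
  star_mul T S := star_eq_of_isAdjointPair ((isAdjointPair_star S).comp (isAdjointPair_star T))
  star_add T S := star_eq_of_isAdjointPair ((isAdjointPair_star T).add (isAdjointPair_star S))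

instance : CompleteSpace (adjointable E) := by
  refine IsComplete.completeSpace_coe (IsClosed.isComplete ?_)
  refine IsSeqClosed.isClosed fun T T' hT hlim => ?_
  let U : ℕ → adjointable E := fun n => ⟨T n, hT n⟩
  have hS : CauchySeq fun n => (star (U n)).1.unop := by
    have hc : CauchySeq T := hlim.cauchySeq
    rw [Metric.cauchySeq_iff] at hc ⊢
    intro ε hε
    obtain ⟨N, hN⟩ := hc ε hε
    refine ⟨N, fun m hm n hn => lt_of_eq_of_lt ?_ (hN m hm n hn)⟩
    rw [dist_eq_norm, dist_eq_norm]
    have := norm_star_adjointable (U m - U n)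
    rw [star_sub] at this
    exact this
  obtain ⟨S, hS⟩ := cauchySeq_tendsto_of_complete hS
  have hT' : Filter.Tendsto (fun n => (T n).unop) Filter.atTop (nhds T'.unop) :=
    (MulOpposite.continuous_unop.tendsto T').comp hlim
  have hSx (z : E) : Filter.Tendsto (fun n => (star (U n)).1.unop z) Filter.atTop (nhds (S z)) :=
    ((ContinuousLinearMap.apply ℂ E z).continuous.tendsto S).comp hS
  have hTx (z : E) : Filter.Tendsto (fun n => (T n).unop z) Filter.atTop (nhds (T'.unop z)) :=
    ((ContinuousLinearMap.apply ℂ E z).continuous.tendsto T'.unop).comp hT'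
  refine ⟨S, fun z x y => ?_, fun z x y => ?_⟩
  · refine tendsto_nhds_unique (((continuous_tern_middle z y).tendsto _).comp (hTx x)) ?_
    refine (((continuous_tern_left x y).tendsto _).comp (hSx z)).congr fun n => ?_
    exact ((isAdjointPair_star (U n)).1 z x y).symm
  · refine tendsto_nhds_unique (((continuous_tern_middle z y).tendsto _).comp (hSx x)) ?_
    refine (((continuous_tern_left x y).tendsto _).comp (hTx z)).congr fun n => ?_
    exact ((isAdjointPair_star (U n)).2 z x y).symm

instance : CStarAlgebra (adjointable E) where
  norm_mul_self_le T := by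
    have := (isAdjointPair_star T).symm.norm_sq_le
    rw [(isAdjointPair_star T).norm_eq] at this
    exact this
  star_smul c T := star_eq_of_isAdjointPair ((isAdjointPair_star T).smul c)

/-- The operator `θ_{y, z}`, where `θ_{y, z} x = μ (x, y, z)`. -/
def thetaL (y z : E) : E →L[ℂ] E :=
  LinearMap.mkContinuous ((tern.flip y).flip z) (‖y‖ * ‖z‖) fun x =>
    (norm_tern_le x y z).trans_eq (by ring)

theorem thetaL_apply (x y z : E) : thetaL y z x = tern x y z := rfl

theorem norm_thetaL_le (y z : E) : ‖thetaL y z‖ ≤ ‖y‖ * ‖z‖ :=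
  LinearMap.mkContinuous_norm_le _ (by positivity) _

theorem isAdjointPair_thetaL (y z : E) : IsAdjointPair (thetaL y z) (thetaL z y) :=
  ⟨fun w x v => (tern_tern_left w z y x v).symm, fun w x v => (tern_tern_left w y z x v).symm⟩

/-- The operator `θ_{y, z}`, as an element of the algebra of adjointable operators,
sesquilinear in `(y, z)`. -/
def theta : E →ₗ⋆[ℂ] E →ₗ[ℂ] adjointable E :=
  LinearMap.mk₂'ₛₗ (starRingEnd ℂ) (RingHom.id ℂ)
    (fun y z => ⟨MulOpposite.op (thetaL y z), thetaL z y, isAdjointPair_thetaL y z⟩)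
    (fun y y' z => Subtype.ext (MulOpposite.unop_injective (by ext x; simp [thetaL_apply])))
    (fun c y z => Subtype.ext (MulOpposite.unop_injective (by ext x; simp [thetaL_apply])))
    (fun y z z' => Subtype.ext (MulOpposite.unop_injective (by ext x; simp [thetaL_apply])))
    (fun c y z => Subtype.ext (MulOpposite.unop_injective (by ext x; simp [thetaL_apply])))

theorem theta_apply (x y z : E) : (theta y z).1.unop x = tern x y z := rfl

theorem star_theta (y z : E) : star (theta y z) = theta z y :=
  star_eq_of_isAdjointPair (isAdjointPair_thetaL y z)

theorem theta_mul (x y : E) (T : adjointable E) : theta x y * T = theta x (T.1.unop y) := by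
  refine Subtype.ext (MulOpposite.unop_injective (ContinuousLinearMap.ext fun z => ?_))
  change T.1.unop (tern z x y) = tern z x (T.1.unop y)
  refine eq_of_tern fun u v => ?_
  rw [← (isAdjointPair_star T).2, tern_tern_left, tern_tern_left, (isAdjointPair_star T).1]

variable (E) in
/-- The linear span of the operators `θ_{y, z}`. -/
def thetaSpan : Submodule ℂ (adjointable E) := Submodule.span ℂ {b | ∃ x y : E, b = theta x y}

theorem thetaSpan_mul_mem {a : adjointable E} (ha : a ∈ thetaSpan E) (T : adjointable E) :
    a * T ∈ thetaSpan E := by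
  induction ha using Submodule.span_induction with
  | mem a h =>
    obtain ⟨x, y, rfl⟩ := h
    rw [theta_mul]
    exact Submodule.subset_span ⟨_, _, rfl⟩
  | zero => rw [zero_mul]; exact zero_mem _
  | add a b _ _ iha ihb => rw [add_mul]; exact add_mem iha ihb
  | smul c a _ iha => rw [smul_mul_assoc]; exact Submodule.smul_mem _ _ iha

theorem star_mem_thetaSpan {a : adjointable E} (ha : a ∈ thetaSpan E) : star a ∈ thetaSpan E := by
  induction ha using Submodule.span_induction with
  | mem a h =>
    obtain ⟨x, y, rfl⟩ := h
    rw [star_theta]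
    exact Submodule.subset_span ⟨_, _, rfl⟩
  | zero => rw [star_zero]; exact zero_mem _
  | add a b _ _ iha ihb => rw [star_add]; exact add_mem iha ihb
  | smul c a _ iha => rw [star_smul]; exact Submodule.smul_mem _ _ iha

variable (E) in
/-- The right associated `C*`-algebra `B_E` of `E`: the closed linear span of the operators
`θ_{y, z}` in the `C*`-algebra of adjointable operators. -/
def rightAlgebra : NonUnitalStarSubalgebra ℂ (adjointable E) where
  toSubmodule := (thetaSpan E).topologicalClosure
  mul_mem' := fun {_ b} ha _ =>
    map_mem_closure (f := fun x => x * b) (continuous_mul_const b) ha fun _ hx =>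
      thetaSpan_mul_mem hx b
  star_mem' := fun {_} ha =>
    map_mem_closure continuous_star ha fun _ hx => star_mem_thetaSpan hx

instance : IsClosed (rightAlgebra E : Set (adjointable E)) :=
  (thetaSpan E).isClosed_topologicalClosure

variable (E) in
/-- The right associated `C*`-algebra `B_E` of `E`, as a type. -/
def RightAlgebra : Type _ := rightAlgebra E

instance : NonUnitalCStarAlgebra (RightAlgebra E) :=
  inferInstanceAs (NonUnitalCStarAlgebra (rightAlgebra E))

variable (E) in
/-- The inclusion of `B_E` into the adjointable operators. -/
def RightAlgebra.val : RightAlgebra E →⋆ₙₐ[ℂ] adjointable E :=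
  { toFun := fun b => Subtype.val (p := fun a => a ∈ rightAlgebra E) b
    map_smul' := fun _ _ => rfl
    map_zero' := rfl
    map_add' := fun _ _ => rfl
    map_mul' := fun _ _ => rfl
    map_star' := fun _ => rfl }

theorem RightAlgebra.val_injective : Function.Injective (RightAlgebra.val E) :=
  Subtype.val_injective

theorem RightAlgebra.norm_val (b : RightAlgebra E) : ‖RightAlgebra.val E b‖ = ‖b‖ := rfl

/-- The `B_E`-valued sesquilinear map `⟨y, z⟩ = θ_{y, z}`. -/
def rightInner : E →ₗ⋆[ℂ] E →ₗ[ℂ] RightAlgebra E :=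
  LinearMap.mk₂'ₛₗ (starRingEnd ℂ) (RingHom.id ℂ)
    (fun y z => (⟨theta y z, Submodule.le_topologicalClosure _
      (Submodule.subset_span ⟨y, z, rfl⟩)⟩ : rightAlgebra E))
    (fun y y' z => RightAlgebra.val_injective (LinearMap.map_add₂ theta y y' z))
    (fun c y z => RightAlgebra.val_injective (LinearMap.map_smulₛₗ₂ theta c y z))
    (fun y z z' => RightAlgebra.val_injective ((theta y).map_add z z'))
    (fun c y z => RightAlgebra.val_injective ((theta y).map_smul c z))

theorem RightAlgebra.val_rightInner (y z : E) :
    RightAlgebra.val E (rightInner y z) = theta y z := rfl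

theorem exists_mem_span_rightInner {a : adjointable E} (ha : a ∈ thetaSpan E) :
    ∃ b ∈ Submodule.span ℂ {b : RightAlgebra E | ∃ x y : E, b = rightInner x y},
      RightAlgebra.val E b = a := by
  induction ha using Submodule.span_induction with
  | mem a h =>
    obtain ⟨x, y, rfl⟩ := h
    exact ⟨rightInner x y, Submodule.subset_span ⟨x, y, rfl⟩, rfl⟩
  | zero => exact ⟨0, zero_mem _, map_zero _⟩
  | add a b _ _ iha ihb =>
    obtain ⟨a', ha', rfl⟩ := iha
    obtain ⟨b', hb', rfl⟩ := ihb
    exact ⟨a' + b', add_mem ha' hb', map_add _ _ _⟩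
  | smul c a _ iha =>
    obtain ⟨a', ha', rfl⟩ := iha
    exact ⟨c • a', Submodule.smul_mem _ _ ha', map_smul _ _ _⟩

theorem RightAlgebra.isometry_val : Isometry (RightAlgebra.val E) :=
  AddMonoidHomClass.isometry_of_norm _ RightAlgebra.norm_val

theorem dense_span_rightInner : Dense
    (Submodule.span ℂ {b : RightAlgebra E | ∃ x y : E, b = rightInner x y} :
      Set (RightAlgebra E)) := by
  intro b
  rw [RightAlgebra.isometry_val.isEmbedding.closure_eq_preimage_closure_image]
  have hb : RightAlgebra.val E b ∈ closure (thetaSpan E : Set (adjointable E)) := b.2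
  exact closure_mono (fun a ha => exists_mem_span_rightInner ha) hb

variable (E) in
/-- The canonical right associated pair of `E`: the algebra `B_E`, with its tautological right
action on `E` and with `⟨y, z⟩ = θ_{y, z}`. -/
def rightPair : RightAssociatedPair E (RightAlgebra E) where
  act := LinearMap.mk₂ ℂ (fun x b => (RightAlgebra.val E b).1.unop x)
    (fun _ _ _ => map_add _ _ _) (fun _ _ _ => map_smul _ _ _)
    (fun _ _ _ => rfl) (fun _ _ _ => rfl)
  act_mul _ _ _ := rfl
  norm_act_le x b := ((RightAlgebra.val E b).1.unop.le_opNorm x).trans_eq (mul_comm _ _)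
  inner := rightInner
  norm_inner_le x y := norm_thetaL_le x y
  inner_act x y b := RightAlgebra.val_injective (theta_mul x y (RightAlgebra.val E b)).symm
  star_inner x y := RightAlgebra.val_injective (star_theta x y)
  tern_eq_act _ _ _ := rfl
  dense_span := dense_span_rightInner

end CStarTernaryRing

/-! ## Tensor products -/

section TensorProduct

variable {E F : Type*}

section

variable [AddCommGroup E] [Module ℂ E] [StarTernaryRing E]
  [AddCommGroup F] [Module ℂ F] [StarTernaryRing F]

/-- The ternary product `μ ⊙ ν` on the algebraic tensor product `E ⊙ F`. -/
def tensorTern :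
    E ⊗[ℂ] F →ₗ[ℂ] E ⊗[ℂ] F →ₗ⋆[ℂ] E ⊗[ℂ] F →ₗ[ℂ] E ⊗[ℂ] F :=
  (TensorProduct.map₂ (tern (E := E)) (tern (E := F))).compr₂ₛₗ
    (TensorProduct.homTensorHomMap (RingHom.id ℂ) E F E F)

theorem tensorTern_tmul (e e' e'' : E) (f f' f'' : F) :
    tensorTern (e ⊗ₜ[ℂ] f) (e' ⊗ₜ f') (e'' ⊗ₜ f'') = tern e e' e'' ⊗ₜ[ℂ] tern f f' f'' := by
  simp [tensorTern]

/-- The algebraic tensor product of two `*`-ternary rings is a `*`-ternary ring. -/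
instance : StarTernaryRing (E ⊗[ℂ] F) where
  tern := tensorTern
  tern_tern_left x y z u v := by
    induction x with
    | zero => simp
    | add a b ha hb => simp only [map_add, LinearMap.add_apply, ha, hb]
    | tmul x₁ x₂ =>
      induction y with
      | zero => simp
      | add a b ha hb => simp only [map_add, LinearMap.add_apply, ha, hb]
      | tmul y₁ y₂ =>
        induction z with
        | zero => simp
        | add a b ha hb => simp only [map_add, LinearMap.add_apply, ha, hb]
        | tmul z₁ z₂ =>
          induction u with
          | zero => simp
          | add a b ha hb => simp only [map_add, LinearMap.add_apply, ha, hb]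
          | tmul u₁ u₂ =>
            induction v with
            | zero => simp
            | add a b ha hb => simp only [map_add, ha, hb]
            | tmul v₁ v₂ =>
              simp only [tensorTern_tmul, tern_tern_left]
  tern_tern_right x y z u v := by
    induction x with
    | zero => simp
    | add a b ha hb => simp only [map_add, LinearMap.add_apply, ha, hb]
    | tmul x₁ x₂ =>
      induction y with
      | zero => simp
      | add a b ha hb => simp only [map_add, LinearMap.add_apply, ha, hb]
      | tmul y₁ y₂ =>
        induction z with
        | zero => simp
        | add a b ha hb => simp only [map_add, LinearMap.add_apply, ha, hb]
        | tmul z₁ z₂ =>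
          induction u with
          | zero => simp
          | add a b ha hb => simp only [map_add, LinearMap.add_apply, ha, hb]
          | tmul u₁ u₂ =>
            induction v with
            | zero => simp
            | add a b ha hb => simp only [map_add, ha, hb]
            | tmul v₁ v₂ =>
              simp only [tensorTern_tmul, tern_tern_right]

end

variable [NormedAddCommGroup E] [NormedSpace ℂ E] [CStarTernaryRing E]
  [NormedAddCommGroup F] [NormedSpace ℂ F] [CStarTernaryRing F]
  {B C : Type*} [NonUnitalCStarAlgebra B] [NonUnitalCStarAlgebra C]

/-- The sesquilinear map `⟨e ⊙ f, e' ⊙ f'⟩ = ⟨e, e'⟩ ⊙ ⟨f, f'⟩` on `E ⊙ F`, with values in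
`B_E ⊙ B_F`. -/
def tensorInner (p : RightAssociatedPair E B) (q : RightAssociatedPair F C) :
    E ⊗[ℂ] F →ₗ⋆[ℂ] E ⊗[ℂ] F →ₗ[ℂ] B ⊗[ℂ] C :=
  TensorProduct.map₂ p.inner q.inner

theorem tensorInner_tmul (p : RightAssociatedPair E B) (q : RightAssociatedPair F C)
    (e e' : E) (f f' : F) :
    tensorInner p q (e ⊗ₜ f) (e' ⊗ₜ f') = p.inner e e' ⊗ₜ[ℂ] q.inner f f' := by
  simp [tensorInner]

/-- The right associated `C*`-algebra of `E ⊗_α F` is the completion `B_E ⊗_γ B_F`: there is a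
`*`-homomorphism from `B_E ⊙ B_F` to the right associated `C*`-algebra of `E ⊗_α F`, isometric for
`γ` and with dense range, that is compatible with the inner products, namely
`⟨e, e'⟩ ⊙ ⟨f, f'⟩ ↦ ⟨e ⊙ f, e' ⊙ f'⟩`. -/
def IsRightAssociatedNorm (p : RightAssociatedPair E B) (q : RightAssociatedPair F C)
    (α : TernaryCStarNorm (E ⊗[ℂ] F)) (γ : CStarNorm (B ⊗[ℂ] C)) : Prop :=
  ∃ j : B ⊗[ℂ] C →⋆ₙₐ[ℂ] CStarTernaryRing.RightAlgebra α.Completion,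
    (∀ e e' f f', j (p.inner e e' ⊗ₜ[ℂ] q.inner f f') =
      (CStarTernaryRing.rightPair α.Completion).inner
        (α.toCompletion (e ⊗ₜ[ℂ] f)) (α.toCompletion (e' ⊗ₜ[ℂ] f'))) ∧
    (∀ t, ‖j t‖ = γ t) ∧ DenseRange j

end TensorProduct

end

/-! The algebra `B_E ⊙ B_F` acts on `E ⊙ F` from the right by `(e ⊙ f)(b ⊙ c) = eb ⊙ fc`, and `x⟨y,
z⟩ = μ(x, y, z)`, `⟨x, yt⟩ = ⟨x, y⟩t`. Both maps between norms compare `t` with the operator `x ↦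
xt`.

From `α` to a norm on `B_E ⊙ B_F`: the action is bounded for every `C*`-norm `α`, because unitaries
of the unitizations contract `α` and span (`isBounded_of_unital`). It extends to the completion as
an injective `*`-homomorphism `tensorHom` into the adjointable operators, taking `⟨x, y⟩` to `θ_{x,
y}`; its range is therefore dense in the right associated algebra, and `associatedNorm` is the
operator norm. A competing `j` agrees with it because both have the same products with all inner
products (`isRightAssociatedNorm_iff`).

From `γ` to a norm on `E ⊙ F`: positivity of `E` and `F` makes Gram matrices positive, so `⟨x, x⟩`
is a finite sum of squares in `B_E ⊙ B_F` (`exists_tensorInner_self_eq_sum`). Embedding `(B_E ⊙ B_F,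
γ)` in a `C*`-algebra yields the Cauchy–Schwarz inequality `sq_map_tensorInner_le`, from which the
norm axioms follow.

The round trip from `α` is `‖θ_{x, x}‖ = ‖x‖²`. For the round trip from `γ`, the inequality `≤` is
`⟨xt, xt⟩ = t*⟨x, x⟩t`. The inequality `≥`, and the monotonicity of `associatedNorm`, use a spectral
radius argument: a bound with an uncontrolled constant, applied to the powers `h ^ (2 ^ n)` of a
self-adjoint `h`, becomes sharp after taking roots (`le_mul_of_sq_le_seq`). -/

noncomputable section

open StarTernaryRing

/-! ### Positive matrices over a `C*`-algebra and Gram matrices. -/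

section Positivity

/-- `N` is the negative part of `A`. The order is hidden inside the proof and positivity expressed
by squares, so that the result applies to a matrix algebra without choosing an order on it. -/
theorem IsSelfAdjoint.exists_negPart {M : Type*} [NonUnitalCStarAlgebra M] {A : M}
    (hA : IsSelfAdjoint A) : ∃ N D : M, star N = N ∧ N = star D * D ∧ A * N = -(N * N) ∧
      (N = 0 → ∃ c, A = star c * c) := by
  let _ := CStarAlgebra.spectralOrder M
  let _ := CStarAlgebra.spectralOrderedRing M
  have hN0 : 0 ≤ A⁻ := CFC.negPart_nonneg A
  obtain ⟨D, hD⟩ := CStarAlgebra.nonneg_iff_eq_star_mul_self.1 hN0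
  refine ⟨A⁻, D, hN0.isSelfAdjoint, hD, ?_, fun h => ?_⟩
  · nth_rw 1 [← CFC.posPart_sub_negPart A hA]
    rw [sub_mul, CFC.posPart_mul_negPart, zero_sub]
  · refine CStarAlgebra.nonneg_iff_eq_star_mul_self.1 ?_
    rw [← CFC.posPart_sub_negPart A hA, h, sub_zero]
    exact CFC.posPart_nonneg A

/-- Testing the form on the columns of `N = A⁻` shows that the diagonal of `N A N = -N³` is
nonnegative. With `N = D* D`, the matrix `N³ = (D N)* (D N)` has sums of squares on its diagonal, so
`D N = 0`; hence `N = 0` and `A` is positive. -/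
theorem CStarMatrix.exists_eq_star_mul_self {ι B : Type*} [Fintype ι] [NonUnitalCStarAlgebra B]
    [PartialOrder B] [StarOrderedRing B] (A : CStarMatrix ι ι B) (hA : IsSelfAdjoint A)
    (h : ∀ b : ι → B, 0 ≤ ∑ i, ∑ j, star (b i) * A i j * b j) : ∃ c, A = star c * c := by
  obtain ⟨N, D, hNs, hD, hAN, hN⟩ := hA.exists_negPart
  refine hN ?_
  have hM : star (D * N) * (D * N) = -(N * A * N) := by
    rw [star_mul, hNs, mul_assoc, ← mul_assoc (star D), ← hD, mul_assoc N A, hAN, mul_neg, neg_neg]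
  have hM0 : D * N = 0 := by
    ext k j
    have h1 : (star (D * N) * (D * N)) j j = ∑ k, star ((D * N) k j) * (D * N) k j := by
      rw [CStarMatrix.mul_apply]; rfl
    have h2 : (N * A * N) j j = ∑ i, ∑ k, star (N i j) * A i k * N k j := by
      rw [CStarMatrix.mul_apply, Finset.sum_comm]
      refine Finset.sum_congr rfl fun k _ => ?_
      rw [CStarMatrix.mul_apply, Finset.sum_mul]
      refine Finset.sum_congr rfl fun i _ => ?_
      rw [← CStarMatrix.star_apply, hNs]
    have h3 : ∑ k, star ((D * N) k j) * (D * N) k j ≤ 0 := by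
      rw [← h1, hM, CStarMatrix.neg_apply, h2]
      exact neg_nonpos.2 (h fun i => N i j)
    have h4 : ∀ k ∈ Finset.univ, 0 ≤ star ((D * N) k j) * (D * N) k j := fun k _ =>
      star_mul_self_nonneg _
    exact CStarRing.star_mul_self_eq_zero_iff _ |>.1
      ((Finset.sum_eq_zero_iff_of_nonneg h4).1 (le_antisymm h3 (Finset.sum_nonneg h4)) k
        (Finset.mem_univ k))
  have hN2 : N * N = 0 := by
    have : star (N * N) * (N * N) = 0 := by
      rw [star_mul, hNs]
      nth_rw 1 [hD]
      rw [mul_assoc, mul_assoc, ← mul_assoc D N, hM0]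
      simp
    exact CStarRing.star_mul_self_eq_zero_iff _ |>.1 this
  rw [← CStarRing.star_mul_self_eq_zero_iff, hNs, hN2]

end Positivity

namespace RightAssociatedPair

variable {E : Type*} [NormedAddCommGroup E] [NormedSpace ℂ E] [CStarTernaryRing E]
  {B : Type*} [NonUnitalCStarAlgebra B] (p : RightAssociatedPair E B)

theorem inner_act_left (x y : E) (b : B) : p.inner (p.act x b) y = star b * p.inner x y := by
  rw [← p.star_inner, p.inner_act, star_mul, p.star_inner]

variable {p}

/-- The matrix criterion applies because `∑ bᵢ* ⟨eᵢ, eⱼ⟩ bⱼ = ⟨x, x⟩` for `x = ∑ eᵢ bᵢ`. -/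
theorem IsPositive.exists_gram_eq (hp : p.IsPositive) {ι : Type*} [Fintype ι] (e : ι → E) :
    ∃ c : ι → ι → B, ∀ i j, p.inner (e i) (e j) = ∑ k, star (c k i) * c k j := by
  let _ := CStarAlgebra.spectralOrder B
  let _ := CStarAlgebra.spectralOrderedRing B
  let A : CStarMatrix ι ι B := CStarMatrix.ofMatrix fun i j => p.inner (e i) (e j)
  have hA : ∃ c, A = star c * c := by
    refine CStarMatrix.exists_eq_star_mul_self A ?_ fun b => ?_
    · ext i j
      exact p.star_inner _ _
    · obtain ⟨c, hc⟩ := hp (∑ i, p.act (e i) (b i))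
      have : ∑ i, ∑ j, star (b i) * A i j * b j =
          p.inner (∑ i, p.act (e i) (b i)) (∑ i, p.act (e i) (b i)) := by
        simp only [map_sum, LinearMap.sum_apply, p.inner_act, p.inner_act_left]
        rw [Finset.sum_comm]
        rfl
      rw [this, hc]
      exact star_mul_self_nonneg c
  obtain ⟨c, hc⟩ := hA
  refine ⟨fun i j => c i j, fun i j => ?_⟩
  have := congrFun (congrFun hc i) j
  rw [CStarMatrix.mul_apply] at this
  exact this

end RightAssociatedPair

/-! ### Separating families of maps on algebraic tensor products. -/

section Separation

variable {V W V' W' : Type*} [AddCommGroup V] [Module ℂ V] [AddCommGroup W] [Module ℂ W]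
  [AddCommGroup V'] [Module ℂ V'] [AddCommGroup W'] [Module ℂ W']

/-- A basis of `W` identifies `V ⊗ W` with finitely supported families in `V`, on which `S i ⊗ id`
acts coordinatewise. -/
theorem TensorProduct.eq_zero_of_rTensor_eq_zero {ι : Type*} (S : ι → V →ₗ[ℂ] V')
    (hS : ∀ v, (∀ i, S i v = 0) → v = 0) (x : V ⊗[ℂ] W)
    (hx : ∀ i, (S i).rTensor W x = 0) : x = 0 := by
  classical
  let b := Module.Basis.ofVectorSpace ℂ W
  have key : ∀ (i) (x : V ⊗[ℂ] W) (k), equivFinsuppOfBasisRight b ((S i).rTensor W x) k =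
      S i (equivFinsuppOfBasisRight b x k) := fun i x k => by
    induction x with
    | zero => simp
    | add x y hx hy => simp only [map_add, Finsupp.add_apply, hx, hy]
    | tmul v w => simp
  apply (equivFinsuppOfBasisRight (M := V) b).injective
  ext k
  rw [map_zero, Finsupp.zero_apply]
  exact hS _ fun i => by rw [← key, hx, map_zero, Finsupp.zero_apply]

theorem TensorProduct.eq_zero_of_map_eq_zero {ι κ : Type*} (S : ι → V →ₗ[ℂ] V')
    (T : κ → W →ₗ[ℂ] W') (hS : ∀ v, (∀ i, S i v = 0) → v = 0)
    (hT : ∀ w, (∀ k, T k w = 0) → w = 0) (x : V ⊗[ℂ] W)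
    (hx : ∀ i k, TensorProduct.map (S i) (T k) x = 0) : x = 0 := by
  refine eq_zero_of_rTensor_eq_zero S hS x fun i => ?_
  apply (TensorProduct.comm ℂ V' W).injective
  rw [map_zero]
  refine eq_zero_of_rTensor_eq_zero T hT _ fun k => ?_
  have : ∀ x : V ⊗[ℂ] W, (T k).rTensor V' (TensorProduct.comm ℂ V' W ((S i).rTensor W x)) =
      TensorProduct.comm ℂ V' W' (TensorProduct.map (S i) (T k) x) := fun x => by
    induction x with
    | zero => simp
    | add x y hx hy => simp only [map_add, hx, hy]
    | tmul v w => simp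
  rw [this, hx, map_zero]

end Separation

/-! ### Actions by adjointable maps: automatic boundedness and extension to the completion. -/

/-- A right action of a `*`-algebra `A` on a `*`-ternary ring `V` by adjointable linear maps. -/
structure TernaryRep (A V : Type*) [NonUnitalRing A] [Module ℂ A] [StarRing A]
    [AddCommGroup V] [Module ℂ V] [StarTernaryRing V] where
  toLin : A →ₗ[ℂ] V →ₗ[ℂ] V
  map_mul : ∀ a b x, toLin (a * b) x = toLin b (toLin a x)
  tern_map : ∀ a z x y, tern z (toLin a x) y = tern (toLin (star a) z) x y

namespace TernaryRep

section Algebraic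

variable {A A' V W : Type*} [NonUnitalRing A] [Module ℂ A] [StarRing A]
  [NonUnitalRing A'] [Module ℂ A'] [StarRing A']
  [AddCommGroup V] [Module ℂ V] [StarTernaryRing V]
  [AddCommGroup W] [Module ℂ W] [StarTernaryRing W]

/-- The pullback of an action along a `*`-homomorphism. -/
def comp (r : TernaryRep A V) (f : A' →⋆ₙₐ[ℂ] A) : TernaryRep A' V where
  toLin := r.toLin ∘ₗ (f : A' →ₗ[ℂ] A)
  map_mul a b x := by simp [r.map_mul]
  tern_map a z x y := by simp [r.tern_map, map_star]

/-- The action on the first factor of a tensor product. -/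
def rTensor (r : TernaryRep A V) (W : Type*) [AddCommGroup W] [Module ℂ W] [StarTernaryRing W] :
    TernaryRep A (V ⊗[ℂ] W) where
  toLin := LinearMap.rTensorHom W ∘ₗ r.toLin
  map_mul a b x := by
    induction x with
    | zero => simp
    | add x y hx hy => simp only [map_add, hx, hy]
    | tmul v w => simp [r.map_mul]
  tern_map a z x y := by
    induction z with
    | zero => simp
    | add z z' hz hz' => simp only [map_add, LinearMap.add_apply, hz, hz']
    | tmul z z' =>
      induction x with
      | zero => simp
      | add x x' hx hx' => simp only [map_add, LinearMap.add_apply, hx, hx']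
      | tmul x x' =>
        induction y with
        | zero => simp
        | add y y' hy hy' => simp only [map_add, hy, hy']
        | tmul y y' =>
          simp only [LinearMap.comp_apply, LinearMap.coe_rTensorHom, LinearMap.rTensor_tmul]
          change tensorTern _ _ _ = tensorTern _ _ _
          simp only [tensorTern_tmul, r.tern_map]

/-- The action on the second factor of a tensor product. -/
def lTensor (r : TernaryRep A W) (V : Type*) [AddCommGroup V] [Module ℂ V] [StarTernaryRing V] :
    TernaryRep A (V ⊗[ℂ] W) where
  toLin := LinearMap.lTensorHom V ∘ₗ r.toLin
  map_mul a b x := by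
    induction x with
    | zero => simp
    | add x y hx hy => simp only [map_add, hx, hy]
    | tmul v w => simp [r.map_mul]
  tern_map a z x y := by
    induction z with
    | zero => simp
    | add z z' hz hz' => simp only [map_add, LinearMap.add_apply, hz, hz']
    | tmul z z' =>
      induction x with
      | zero => simp
      | add x x' hx hx' => simp only [map_add, LinearMap.add_apply, hx, hx']
      | tmul x x' =>
        induction y with
        | zero => simp
        | add y y' hy hy' => simp only [map_add, hy, hy']
        | tmul y y' =>
          simp only [LinearMap.comp_apply, LinearMap.coe_lTensorHom, LinearMap.lTensor_tmul]
          change tensorTern _ _ _ = tensorTern _ _ _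
          simp only [tensorTern_tmul, r.tern_map]

theorem rTensor_tmul (r : TernaryRep A V) (a : A) (v : V) (w : W) :
    (r.rTensor W).toLin a (v ⊗ₜ w) = r.toLin a v ⊗ₜ w := rfl

theorem lTensor_tmul (r : TernaryRep A W) (a : A) (v : V) (w : W) :
    (r.lTensor V).toLin a (v ⊗ₜ w) = v ⊗ₜ r.toLin a w := rfl

/-- The action `a` is bounded for the norm `α`, for all `a`. -/
def IsBounded (r : TernaryRep A V) (α : TernaryCStarNorm V) : Prop :=
  ∀ a, ∃ C, ∀ x, α (r.toLin a x) ≤ C * α x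

/-- Since `u u* = 1`, `μ(xu, xu, xu) = μ(x, x, xu)`, so `α(xu)³ ≤ α(x)² α(xu)`. -/
theorem map_unitary_le {A : Type*} [CStarAlgebra A] (r : TernaryRep A V) (h1 : ∀ x, r.toLin 1 x = x)
    (α : TernaryCStarNorm V) {u : A} (hu : u ∈ unitary A) (x : V) : α (r.toLin u x) ≤ α x := by
  have h0 : 0 ≤ α x := apply_nonneg α.toSeminorm x
  have h0' : 0 ≤ α (r.toLin u x) := apply_nonneg α.toSeminorm _
  have h3 : α (r.toLin u x) ^ 3 ≤ α x * α x * α (r.toLin u x) := by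
    rw [← α.map_tern_self, r.tern_map, ← r.map_mul, (Unitary.mem_iff.1 hu).2, h1]
    exact α.map_tern_le _ _ _
  rcases h0'.eq_or_lt with h | h
  · rw [← h]; exact h0
  · have : α (r.toLin u x) ^ 2 ≤ α x ^ 2 :=
      le_of_mul_le_mul_right (by calc
        _ = α (r.toLin u x) ^ 3 := by ring
        _ ≤ _ := h3
        _ = α x ^ 2 * α (r.toLin u x) := by ring) h
    exact le_of_sq_le_sq this h0

/-- Unitaries span a unital `C*`-algebra. Nothing relates `α` to the norm of `A`; the constants
obtained here are crude and serve only to extend the action to the completion. -/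
theorem isBounded_of_unital {A : Type*} [CStarAlgebra A] (r : TernaryRep A V)
    (h1 : ∀ x, r.toLin 1 x = x) (α : TernaryCStarNorm V) : r.IsBounded α := fun a => by
  have ha : a ∈ Submodule.span ℂ (unitary A : Set A) := by
    rw [CStarAlgebra.span_unitary]; trivial
  induction ha using Submodule.span_induction with
  | mem u hu => exact ⟨1, fun x => by rw [one_mul]; exact r.map_unitary_le h1 α hu x⟩
  | zero => exact ⟨0, fun x => by simp⟩
  | add a b _ _ ha hb =>
    obtain ⟨C, hC⟩ := ha
    obtain ⟨C', hC'⟩ := hb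
    refine ⟨C + C', fun x => ?_⟩
    rw [map_add, LinearMap.add_apply, add_mul]
    exact (map_add_le_add α.toSeminorm _ _).trans (add_le_add (hC x) (hC' x))
  | smul c a _ ha =>
    obtain ⟨C, hC⟩ := ha
    refine ⟨‖c‖ * C, fun x => ?_⟩
    rw [map_smul, LinearMap.smul_apply, mul_assoc]
    exact (map_smul_eq_mul α.toSeminorm _ _).le.trans
      (mul_le_mul_of_nonneg_left (hC x) (norm_nonneg c))

theorem IsBounded.comp {r : TernaryRep A V} {α : TernaryCStarNorm V} (hr : r.IsBounded α)
    (f : A' →⋆ₙₐ[ℂ] A) : (r.comp f).IsBounded α := fun a => hr (f a)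

end Algebraic

section Extension

open CStarTernaryRing

variable {A V : Type*} [NonUnitalRing A] [Module ℂ A] [StarRing A]
  [AddCommGroup V] [Module ℂ V] [StarTernaryRing V] {r : TernaryRep A V} {α : TernaryCStarNorm V}

/-- The continuous extension of a bounded action to the completion. -/
def IsBounded.extend (hr : r.IsBounded α) (a : A) : α.Completion →L[ℂ] α.Completion :=
  extendAlong (RingHom.id ℂ) α.Completion α.incl α.denseRange_incl
    (LinearMap.mkContinuousOfExistsBound
      (α.incl.toLinearMap ∘ₗ (show α.Carrier →ₗ[ℂ] α.Carrier from r.toLin a)) (by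
        obtain ⟨C, hC⟩ := hr a
        exact ⟨C, fun x => (α.incl.norm_map _).trans_le (hC x)⟩))

theorem IsBounded.extend_toCompletion (hr : r.IsBounded α) (a : A) (x : V) :
    hr.extend a (α.toCompletion x) = α.toCompletion (r.toLin a x) :=
  extendAlong_apply _ _ _ _ _ _

theorem _root_.TernaryCStarNorm.denseRange_toCompletion (α : TernaryCStarNorm V) :
    DenseRange α.toCompletion := α.denseRange_incl

theorem _root_.TernaryCStarNorm.ext_toCompletion {α : TernaryCStarNorm V}
    {f g : α.Completion →L[ℂ] α.Completion}
    (h : ∀ x, f (α.toCompletion x) = g (α.toCompletion x)) : f = g :=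
  α.ext_completion h

theorem IsBounded.isAdjointPair_extend (hr : r.IsBounded α) (a : A) :
    IsAdjointPair (hr.extend a) (hr.extend (star a)) := by
  have key₀ : ∀ (a : A) (z x y : V), tern (α.toCompletion z) (hr.extend a (α.toCompletion x))
      (α.toCompletion y) = tern (hr.extend (star a) (α.toCompletion z)) (α.toCompletion x)
      (α.toCompletion y) := fun a z x y => by
    simp only [hr.extend_toCompletion, α.tern_toCompletion, r.tern_map]
  have key : ∀ a z x y, tern z (hr.extend a x) y = tern (hr.extend (star a) z) x y := by
    intro a z x y
    change α.ternCompletion z (hr.extend a x) y = α.ternCompletion (hr.extend (star a) z) x y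
    apply α.completion_induction z
    · apply isClosed_eq <;> fun_prop
    intro z
    apply α.completion_induction x
    · apply isClosed_eq <;> fun_prop
    intro x
    apply α.completion_induction y
    · apply isClosed_eq <;> fun_prop
    intro y
    exact key₀ a z x y
  refine ⟨key a, fun z x y => ?_⟩
  rw [key, star_star]

/-- The `*`-homomorphism into the algebra of adjointable operators of the completion that is
defined by a bounded action. -/
def IsBounded.hom (hr : r.IsBounded α) : A →⋆ₙₐ[ℂ] adjointable α.Completion where
  toFun a := ⟨MulOpposite.op (hr.extend a), _, hr.isAdjointPair_extend a⟩
  map_smul' c a := Subtype.ext (MulOpposite.unop_injective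
    (TernaryCStarNorm.ext_toCompletion fun x => by
      change hr.extend (c • a) _ = c • hr.extend a _
      simp only [hr.extend_toCompletion, map_smul, LinearMap.smul_apply]))
  map_zero' := Subtype.ext (MulOpposite.unop_injective
    (TernaryCStarNorm.ext_toCompletion fun x => by
      change hr.extend 0 _ = 0
      simp only [hr.extend_toCompletion, map_zero, LinearMap.zero_apply]))
  map_add' a b := Subtype.ext (MulOpposite.unop_injective
    (TernaryCStarNorm.ext_toCompletion fun x => by
      change hr.extend (a + b) _ = hr.extend a _ + hr.extend b _
      simp only [hr.extend_toCompletion, map_add, LinearMap.add_apply]))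
  map_mul' a b := Subtype.ext (MulOpposite.unop_injective
    (TernaryCStarNorm.ext_toCompletion fun x => by
      change hr.extend (a * b) _ = hr.extend b (hr.extend a _)
      simp only [hr.extend_toCompletion, r.map_mul]))
  map_star' a := (star_eq_of_isAdjointPair
    (T := ⟨MulOpposite.op (hr.extend a), _, hr.isAdjointPair_extend a⟩)
    (S := ⟨MulOpposite.op (hr.extend (star a)), _, hr.isAdjointPair_extend (star a)⟩)
    (hr.isAdjointPair_extend a)).symm

theorem IsBounded.hom_toCompletion (hr : r.IsBounded α) (a : A) (x : V) :
    (hr.hom a).1.unop (α.toCompletion x) = α.toCompletion (r.toLin a x) :=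
  hr.extend_toCompletion a x

theorem IsBounded.norm_hom_le (hr : r.IsBounded α) (a : A) {C : ℝ} (hC : 0 ≤ C)
    (h : ∀ x, α (r.toLin a x) ≤ C * α x) : ‖hr.hom a‖ ≤ C := by
  refine ContinuousLinearMap.opNorm_le_bound _ hC fun x => ?_
  change ‖hr.extend a x‖ ≤ _
  apply α.completion_induction x
  · apply isClosed_le <;> fun_prop
  intro x
  exact (congrArg norm (hr.extend_toCompletion a x)).trans_le
    ((α.norm_toCompletion _).trans_le ((h x).trans_eq
      (congrArg (C * ·) (α.norm_toCompletion x).symm)))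

theorem IsBounded.map_le (hr : r.IsBounded α) (a : A) (x : V) :
    α (r.toLin a x) ≤ ‖hr.hom a‖ * α x := by
  rw [← α.norm_toCompletion, ← α.norm_toCompletion, ← hr.hom_toCompletion]
  exact (hr.hom a).1.unop.le_opNorm _

/-- Moving `a` across gives `μ(xa, xa, xa) = μ(xaa*, x, xa)`. For self-adjoint `a` this is the
recursion from `a` to `a²` that drives the spectral radius argument. -/
theorem map_sq_le (a : A) (x : V) :
    α (r.toLin a x) ^ 2 ≤ α (r.toLin (a * star a) x) * α x := by
  have h0' : 0 ≤ α (r.toLin a x) := apply_nonneg α.toSeminorm _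
  have h3 : α (r.toLin a x) ^ 3 ≤ α (r.toLin (a * star a) x) * α x * α (r.toLin a x) := by
    rw [← α.map_tern_self, r.tern_map, ← r.map_mul]
    exact α.map_tern_le _ _ _
  rcases h0'.eq_or_lt with h | h
  · rw [← h, zero_pow two_ne_zero]
    exact mul_nonneg (apply_nonneg α.toSeminorm _) (apply_nonneg α.toSeminorm _)
  · exact le_of_mul_le_mul_right (by rw [← pow_succ]; exact h3) h

end Extension

end TernaryRep

/-! ### Nondegeneracy of the associated pair and the action of the unitization. -/

namespace RightAssociatedPair

variable {E : Type*} [NormedAddCommGroup E] [NormedSpace ℂ E] [CStarTernaryRing E]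
  {B : Type*} [NonUnitalCStarAlgebra B] (p : RightAssociatedPair E B)

theorem dense_induction {P : B → Prop} (hc : IsClosed {b | P b}) (h0 : P 0)
    (hi : ∀ x y, P (p.inner x y)) (ha : ∀ a b, P a → P b → P (a + b))
    (hs : ∀ (c : ℂ) a, P a → P (c • a)) (b : B) : P b := by
  refine p.dense_span.induction (fun b hb => ?_) hc b
  induction hb using Submodule.span_induction with
  | mem b hb => obtain ⟨x, y, rfl⟩ := hb; exact hi x y
  | zero => exact h0
  | add a b _ _ iha ihb => exact ha a b iha ihb
  | smul c a _ iha => exact hs c a iha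

/-- Here `⟨x, y⟩ b = ⟨x, yb⟩ = 0`, so by density `B b = 0`, in particular `b* b = 0`. -/
theorem eq_zero_of_act_eq_zero (b : B) (hb : ∀ x, p.act x b = 0) : b = 0 := by
  have h : ∀ c : B, c * b = 0 := p.dense_induction
    (isClosed_eq (continuous_mul_const b) continuous_const) (zero_mul b)
    (fun x y => by rw [← p.inner_act, hb, map_zero])
    (fun a c ha hc => by rw [add_mul, ha, hc, add_zero])
    (fun c a ha => by rw [smul_mul_assoc, ha, smul_zero])
  exact (CStarRing.star_mul_self_eq_zero_iff b).1 (h _)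

theorem eq_zero_of_inner_eq_zero (x : E) (hx : ∀ y, p.inner y x = 0) : x = 0 :=
  CStarTernaryRing.eq_zero_of_tern (by rw [p.tern_eq_act, hx, map_zero])

theorem tern_act (b : B) (z x y : E) : tern z (p.act x b) y = tern (p.act z (star b)) x y := by
  rw [p.tern_eq_act, p.tern_eq_act, p.inner_act_left, p.act_mul]

/-- The action on `E` of the unitization of `B`. -/
def unitizationRep : TernaryRep (Unitization ℂ B) E where
  toLin := LinearMap.mk₂ ℂ (fun a x => a.fst • x + p.act x a.snd)
    (fun a b x => by simp only [Unitization.fst_add, Unitization.snd_add, map_add]; module)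
    (fun c a x => by simp [mul_smul])
    (fun a x y => by simp only [map_add, LinearMap.add_apply]; module)
    (fun c a x => by simp [smul_comm c])
  map_mul a b x := by
    simp only [LinearMap.mk₂_apply, Unitization.fst_mul, Unitization.snd_mul, map_add, map_smul,
      p.act_mul]
    module
  tern_map a z x y := by
    simp only [LinearMap.mk₂_apply, map_add, LinearMap.add_apply, p.tern_act,
      Unitization.fst_star, Unitization.snd_star, map_smulₛₗ, LinearMap.smul_apply]
    rfl

theorem unitizationRep_one (x : E) : p.unitizationRep.toLin 1 x = x := by
  simp [unitizationRep]

theorem unitizationRep_inr (b : B) (x : E) :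
    p.unitizationRep.toLin (Unitization.inrNonUnitalStarAlgHom ℂ B b) x = p.act x b := by
  simp [unitizationRep]

end RightAssociatedPair

/-! ### The action of `B ⊙ C` on `E ⊙ F` and the norm associated with `α`. -/

section Tensor

open CStarTernaryRing

variable {E F : Type*} [NormedAddCommGroup E] [NormedSpace ℂ E] [CStarTernaryRing E]
  [NormedAddCommGroup F] [NormedSpace ℂ F] [CStarTernaryRing F]
  {B C : Type*} [NonUnitalCStarAlgebra B] [NonUnitalCStarAlgebra C]
  (p : RightAssociatedPair E B) (q : RightAssociatedPair F C)

theorem tern_tmul (e e' e'' : E) (f f' f'' : F) :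
    tern (e ⊗ₜ[ℂ] f) (e' ⊗ₜ f') (e'' ⊗ₜ f'') = tern e e' e'' ⊗ₜ[ℂ] tern f f' f'' :=
  tensorTern_tmul e e' e'' f f' f''

/-- The action of `B` on the first factor of `E ⊙ F`. -/
def leftRep (p : RightAssociatedPair E B) (F : Type*) [NormedAddCommGroup F] [NormedSpace ℂ F]
    [CStarTernaryRing F] : TernaryRep B (E ⊗[ℂ] F) :=
  (p.unitizationRep.rTensor F).comp (Unitization.inrNonUnitalStarAlgHom ℂ B)

/-- The action of `C` on the second factor of `E ⊙ F`. -/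
def rightRep (E : Type*) [NormedAddCommGroup E] [NormedSpace ℂ E]
    [CStarTernaryRing E] (q : RightAssociatedPair F C) : TernaryRep C (E ⊗[ℂ] F) :=
  (q.unitizationRep.lTensor E).comp (Unitization.inrNonUnitalStarAlgHom ℂ C)

theorem leftRep_tmul (b : B) (e : E) (f : F) :
    (leftRep p F).toLin b (e ⊗ₜ f) = p.act e b ⊗ₜ f :=
  congrArg (· ⊗ₜ[ℂ] f) (p.unitizationRep_inr b e)

theorem rightRep_tmul (c : C) (e : E) (f : F) :
    (rightRep E q).toLin c (e ⊗ₜ f) = e ⊗ₜ q.act f c :=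
  congrArg (e ⊗ₜ[ℂ] ·) (q.unitizationRep_inr c f)

/-- The action is restricted from the unitization of `B`, where there are enough unitaries. -/
theorem isBounded_leftRep (α : TernaryCStarNorm (E ⊗[ℂ] F)) : (leftRep p F).IsBounded α :=
  (TernaryRep.isBounded_of_unital _ (fun x => by
    induction x with
    | zero => simp
    | add x y hx hy => rw [map_add, hx, hy]
    | tmul e f => rw [TernaryRep.rTensor_tmul, p.unitizationRep_one]) α).comp _

theorem isBounded_rightRep (α : TernaryCStarNorm (E ⊗[ℂ] F)) : (rightRep E q).IsBounded α :=
  (TernaryRep.isBounded_of_unital _ (fun x => by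
    induction x with
    | zero => simp
    | add x y hx hy => rw [map_add, hx, hy]
    | tmul e f => rw [TernaryRep.lTensor_tmul, q.unitizationRep_one]) α).comp _

/-- The linear map underlying the action of `B ⊙ C` on `E ⊙ F`. -/
def tensorAct : B ⊗[ℂ] C →ₗ[ℂ] E ⊗[ℂ] F →ₗ[ℂ] E ⊗[ℂ] F :=
  TensorProduct.homTensorHomMap (RingHom.id ℂ) E F E F ∘ₗ
    TensorProduct.map p.act.flip q.act.flip

theorem tensorAct_tmul (b : B) (c : C) (e : E) (f : F) :
    tensorAct p q (b ⊗ₜ c) (e ⊗ₜ f) = p.act e b ⊗ₜ q.act f c := rfl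

/-- The action of `B ⊙ C` on `E ⊙ F`. -/
def tensorRep : TernaryRep (B ⊗[ℂ] C) (E ⊗[ℂ] F) where
  toLin := tensorAct p q
  map_mul s t x := by
    induction x with
    | zero => simp
    | add x y hx hy => simp only [map_add, hx, hy]
    | tmul e f =>
      induction s with
      | zero => simp
      | add s s' hs hs' => simp only [add_mul, map_add, LinearMap.add_apply, hs, hs']
      | tmul b c =>
        induction t with
        | zero => simp
        | add t t' ht ht' => simp only [mul_add, map_add, LinearMap.add_apply, ht, ht']
        | tmul b' c' =>
          rw [Algebra.TensorProduct.tmul_mul_tmul]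
          simp only [tensorAct_tmul, p.act_mul, q.act_mul]
  tern_map t z x y := by
    induction t with
    | zero => simp
    | add t t' ht ht' => simp only [star_add, map_add, LinearMap.add_apply, ht, ht']
    | tmul b c =>
      induction z with
      | zero => simp
      | add z z' hz hz' => simp only [map_add, LinearMap.add_apply, hz, hz']
      | tmul z z' =>
        induction x with
        | zero => simp
        | add x x' hx hx' => simp only [map_add, LinearMap.add_apply, hx, hx']
        | tmul x x' =>
          induction y with
          | zero => simp
          | add y y' hy hy' => simp only [map_add, hy, hy']
          | tmul y y' =>
            simp only [TensorProduct.star_tmul, tensorAct_tmul, tern_tmul, p.tern_act, q.tern_act]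

theorem tensorRep_tmul (b : B) (c : C) (x : E ⊗[ℂ] F) :
    (tensorRep p q).toLin (b ⊗ₜ c) x = (rightRep E q).toLin c ((leftRep p F).toLin b x) := by
  induction x with
  | zero => simp
  | add x y hx hy => simp only [map_add, hx, hy]
  | tmul e f => rw [leftRep_tmul, rightRep_tmul]; rfl

theorem isBounded_tensorRep (α : TernaryCStarNorm (E ⊗[ℂ] F)) : (tensorRep p q).IsBounded α := by
  intro t
  induction t with
  | zero => exact ⟨0, fun x => by simp⟩
  | add a b ha hb =>
    obtain ⟨C, hC⟩ := ha
    obtain ⟨C', hC'⟩ := hb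
    refine ⟨C + C', fun x => ?_⟩
    rw [map_add, LinearMap.add_apply, add_mul]
    exact (map_add_le_add α.toSeminorm _ _).trans (add_le_add (hC x) (hC' x))
  | tmul b c =>
    refine ⟨‖(isBounded_rightRep q α).hom c‖ * ‖(isBounded_leftRep p α).hom b‖, fun x => ?_⟩
    rw [tensorRep_tmul, mul_assoc]
    exact ((isBounded_rightRep q α).map_le c _).trans
      (mul_le_mul_of_nonneg_left ((isBounded_leftRep p α).map_le b x) (norm_nonneg _))

/-- The `*`-homomorphism from `B ⊙ C` to the adjointable operators on `E ⊗_α F`. -/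
def tensorHom (α : TernaryCStarNorm (E ⊗[ℂ] F)) :
    B ⊗[ℂ] C →⋆ₙₐ[ℂ] adjointable α.Completion :=
  (isBounded_tensorRep p q α).hom

variable {p q}
variable (α : TernaryCStarNorm (E ⊗[ℂ] F))

theorem adjointable_ext {S T : adjointable α.Completion}
    (h : ∀ x, S.1.unop (α.toCompletion x) = T.1.unop (α.toCompletion x)) : S = T :=
  Subtype.ext (MulOpposite.unop_injective (TernaryCStarNorm.ext_toCompletion h))

theorem tensorHom_toCompletion (t : B ⊗[ℂ] C) (x : E ⊗[ℂ] F) :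
    (tensorHom p q α t).1.unop (α.toCompletion x) =
      α.toCompletion ((tensorRep p q).toLin t x) :=
  (isBounded_tensorRep p q α).hom_toCompletion t x

theorem tensorHom_tmul (b : B) (c : C) : tensorHom p q α (b ⊗ₜ c) =
    (isBounded_leftRep p α).hom b * (isBounded_rightRep q α).hom c := by
  refine adjointable_ext α fun x => ?_
  change _ = ((isBounded_rightRep q α).hom c).1.unop
    (((isBounded_leftRep p α).hom b).1.unop (α.toCompletion x))
  rw [tensorHom_toCompletion, tensorRep_tmul, TernaryRep.IsBounded.hom_toCompletion,
    TernaryRep.IsBounded.hom_toCompletion]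

/-- The crude constants disappear: each factor acts through a `*`-homomorphism between
`C*`-algebras, which is contractive. -/
theorem norm_tensorHom_tmul_le (b : B) (c : C) : ‖tensorHom p q α (b ⊗ₜ c)‖ ≤ ‖b‖ * ‖c‖ := by
  rw [tensorHom_tmul]
  exact (norm_mul_le _ _).trans (mul_le_mul (NonUnitalStarAlgHom.norm_apply_le _ b)
    (NonUnitalStarAlgHom.norm_apply_le _ c) (norm_nonneg _) (norm_nonneg _))

theorem tensorRep_tensorInner (x y z : E ⊗[ℂ] F) :
    (tensorRep p q).toLin (tensorInner p q y z) x = tern x y z := by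
  induction z with
  | zero => simp
  | add z z' hz hz' => simp only [map_add, LinearMap.add_apply, hz, hz']
  | tmul z z' =>
    induction y with
    | zero => simp
    | add y y' hy hy' => simp only [map_add, LinearMap.add_apply, hy, hy']
    | tmul y y' =>
      induction x with
      | zero => simp
      | add x x' hx hx' => simp only [map_add, LinearMap.add_apply, hx, hx']
      | tmul x x' =>
        rw [tensorInner_tmul, tern_tmul, p.tern_eq_act, q.tern_eq_act]
        rfl

theorem tensorInner_tensorRep (x y : E ⊗[ℂ] F) (t : B ⊗[ℂ] C) :
    tensorInner p q x ((tensorRep p q).toLin t y) = tensorInner p q x y * t := by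
  induction t with
  | zero => simp
  | add t t' ht ht' => simp only [map_add, LinearMap.add_apply, mul_add, ht, ht']
  | tmul b c =>
    induction y with
    | zero => simp
    | add y y' hy hy' => simp only [map_add, add_mul, hy, hy']
    | tmul y y' =>
      induction x with
      | zero => simp
      | add x x' hx hx' => simp only [map_add, LinearMap.add_apply, add_mul, hx, hx']
      | tmul x x' =>
        change tensorInner p q _ (p.act y b ⊗ₜ q.act y' c) = _
        rw [tensorInner_tmul, tensorInner_tmul, Algebra.TensorProduct.tmul_mul_tmul, p.inner_act,
          q.inner_act]

theorem star_tensorInner (x y : E ⊗[ℂ] F) :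
    star (tensorInner p q x y) = tensorInner p q y x := by
  induction y with
  | zero => simp
  | add y y' hy hy' => simp only [map_add, star_add, LinearMap.add_apply, hy, hy']
  | tmul y y' =>
    induction x with
    | zero => simp
    | add x x' hx hx' => simp only [map_add, star_add, LinearMap.add_apply, hx, hx']
    | tmul x x' =>
      rw [tensorInner_tmul, tensorInner_tmul, TensorProduct.star_tmul, p.star_inner, q.star_inner]

theorem tensorHom_tensorInner (x y : E ⊗[ℂ] F) :
    tensorHom p q α (tensorInner p q x y) = theta (α.toCompletion x) (α.toCompletion y) := by
  refine adjointable_ext α fun z => ?_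
  rw [tensorHom_toCompletion, tensorRep_tensorInner, theta_apply, α.tern_toCompletion]

/-- Inner products span dense subspaces of `B` and of `C`, and the cross bound on `f` makes it
continuous in each factor separately, so one factor is approximated at a time. No norm on `B ⊙ C` is
needed. -/
theorem map_mem_of_isClosed {Z : Type*} [NormedAddCommGroup Z] [NormedSpace ℂ Z]
    (f : B ⊗[ℂ] C →ₗ[ℂ] Z) (hf : ∀ b c, ‖f (b ⊗ₜ c)‖ ≤ ‖b‖ * ‖c‖) (S : Submodule ℂ Z)
    (hS : IsClosed (S : Set Z)) (h : ∀ x y, f (tensorInner p q x y) ∈ S) (t : B ⊗[ℂ] C) :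
    f t ∈ S := by
  have hl (c : C) : Continuous fun b => f (b ⊗ₜ c) :=
    AddMonoidHomClass.continuous_of_bound (f ∘ₗ (TensorProduct.mk ℂ B C).flip c) ‖c‖ fun b =>
      (hf b c).trans_eq (mul_comm _ _)
  have hr (b : B) : Continuous fun c => f (b ⊗ₜ c) :=
    AddMonoidHomClass.continuous_of_bound (f ∘ₗ TensorProduct.mk ℂ B C b) ‖b‖ fun c => hf b c
  have h1 : ∀ (b : B) (x y : F), f (b ⊗ₜ q.inner x y) ∈ S := fun b x y =>
    p.dense_induction (P := fun b => f (b ⊗ₜ q.inner x y) ∈ S) (hS.preimage (hl _))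
      (by rw [TensorProduct.zero_tmul, map_zero]; exact zero_mem S)
      (fun e e' => by rw [← tensorInner_tmul]; exact h _ _)
      (fun a b ha hb => by rw [TensorProduct.add_tmul, map_add]; exact add_mem ha hb)
      (fun c a ha => by rw [← TensorProduct.smul_tmul', map_smul]; exact S.smul_mem c ha) b
  induction t with
  | zero => rw [map_zero]; exact zero_mem S
  | add s t hs ht => rw [map_add]; exact add_mem hs ht
  | tmul b c =>
    exact q.dense_induction (P := fun c => f (b ⊗ₜ c) ∈ S) (hS.preimage (hr _))
      (by rw [TensorProduct.tmul_zero, map_zero]; exact zero_mem S) (h1 b)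
      (fun a b ha hb => by rw [TensorProduct.tmul_add, map_add]; exact add_mem ha hb)
      (fun c a ha => by rw [TensorProduct.tmul_smul, map_smul]; exact S.smul_mem c ha) c

theorem tensorHom_mem (t : B ⊗[ℂ] C) : tensorHom p q α t ∈ rightAlgebra α.Completion :=
  map_mem_of_isClosed (p := p) (q := q)
    (tensorHom p q α : B ⊗[ℂ] C →ₗ[ℂ] adjointable α.Completion) (norm_tensorHom_tmul_le α)
    (thetaSpan α.Completion).topologicalClosure (Submodule.isClosed_topologicalClosure _)
    (fun x y => Submodule.le_topologicalClosure _ (Submodule.subset_span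
      ⟨_, _, tensorHom_tensorInner α x y⟩)) t

variable (p q) in
/-- The `*`-homomorphism from `B ⊙ C` to the right associated algebra of `E ⊗_α F`. -/
def rightAlgebraHom : B ⊗[ℂ] C →⋆ₙₐ[ℂ] RightAlgebra α.Completion where
  toFun t := (⟨tensorHom p q α t, tensorHom_mem α t⟩ : rightAlgebra α.Completion)
  map_smul' c a := Subtype.ext (map_smul (tensorHom p q α) c a)
  map_zero' := Subtype.ext (map_zero (tensorHom p q α))
  map_add' a b := Subtype.ext (map_add (tensorHom p q α) a b)
  map_mul' a b := Subtype.ext (map_mul (tensorHom p q α) a b)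
  map_star' a := Subtype.ext (map_star (tensorHom p q α) a)

/-- This makes the associated norm definite. An element of the kernel annihilates `E ⊙ F`, and the
maps `b ↦ eb` and `c ↦ fc` separate points of `B` and of `C`. -/
theorem tensorHom_injective : Function.Injective (tensorHom p q α) := by
  refine (injective_iff_map_eq_zero _).2 fun t ht => ?_
  have h : ∀ x, (tensorRep p q).toLin t x = 0 := fun x => by
    have := tensorHom_toCompletion (p := p) (q := q) α t x
    rw [ht] at this
    refine α.eq_zero_of_map_eq_zero _ ?_
    rw [← α.norm_toCompletion, ← this]
    exact norm_zero
  refine TensorProduct.eq_zero_of_map_eq_zero p.act q.act p.eq_zero_of_act_eq_zero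
    q.eq_zero_of_act_eq_zero t fun e f => ?_
  rw [← h (e ⊗ₜ f)]
  -- What remains is an identity valid for every `t`; the hypotheses on `t` are dropped before the
  -- induction.
  generalize t = t
  induction t with
  | zero => simp
  | add s t hs ht => simp only [map_add, LinearMap.add_apply, hs, ht]
  | tmul b c => rfl

variable (p q) in
/-- The `C*`-norm on `B ⊙ C` associated with a `C*`-norm on `E ⊙ F`. -/
def associatedNorm : CStarNorm (B ⊗[ℂ] C) where
  toSeminorm := (normSeminorm ℂ (adjointable α.Completion)).comp
    (tensorHom p q α : B ⊗[ℂ] C →ₗ[ℂ] adjointable α.Completion)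
  eq_zero_of_map_eq_zero a ha :=
    (injective_iff_map_eq_zero _).1 (tensorHom_injective α) a (norm_eq_zero.1 ha)
  map_mul_le a b := by
    change ‖tensorHom p q α (a * b)‖ ≤ ‖tensorHom p q α a‖ * ‖tensorHom p q α b‖
    rw [map_mul]
    exact norm_mul_le _ _
  map_star_mul_self a := by
    change ‖tensorHom p q α (star a * a)‖ = ‖tensorHom p q α a‖ ^ 2
    rw [map_mul, map_star, CStarRing.norm_star_mul_self, sq]

theorem rightAlgebra_completion_induction {P : RightAlgebra α.Completion → Prop}
    (hc : IsClosed {b | P b}) (h0 : P 0)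
    (hi : ∀ x y, P ((rightPair α.Completion).inner (α.toCompletion x) (α.toCompletion y)))
    (ha : ∀ a b, P a → P b → P (a + b)) (hs : ∀ (c : ℂ) a, P a → P (c • a))
    (b : RightAlgebra α.Completion) : P b := by
  have hb1 : ∀ y : α.Completion, Continuous fun x => (rightPair α.Completion).inner x y := fun y =>
    AddMonoidHomClass.continuous_of_bound ((rightPair α.Completion).inner.flip y) ‖y‖ fun x =>
      ((rightPair α.Completion).norm_inner_le x y).trans_eq (mul_comm _ _)
  have hb2 : ∀ x : α.Completion, Continuous fun y => (rightPair α.Completion).inner x y := fun x =>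
    AddMonoidHomClass.continuous_of_bound ((rightPair α.Completion).inner x) ‖x‖ fun y =>
      (rightPair α.Completion).norm_inner_le x y
  refine (rightPair α.Completion).dense_induction hc h0 (fun x y => ?_) ha hs b
  refine α.denseRange_toCompletion.induction_on x (hc.preimage (hb1 y)) fun x => ?_
  exact α.denseRange_toCompletion.induction_on y (hc.preimage (hb2 _)) fun y => hi x y

theorem rightAlgebraHom_tensorInner (x y : E ⊗[ℂ] F) :
    rightAlgebraHom p q α (tensorInner p q x y) =
      (rightPair α.Completion).inner (α.toCompletion x) (α.toCompletion y) :=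
  RightAlgebra.val_injective (tensorHom_tensorInner α x y)

theorem denseRange_rightAlgebraHom : DenseRange (rightAlgebraHom p q α) := by
  let S : Submodule ℂ (RightAlgebra α.Completion) := (LinearMap.range
    (rightAlgebraHom p q α : B ⊗[ℂ] C →ₗ[ℂ] RightAlgebra α.Completion)).topologicalClosure
  intro b
  change b ∈ S
  exact rightAlgebra_completion_induction α (P := (· ∈ S))
    (Submodule.isClosed_topologicalClosure _) (zero_mem _)
    (fun x y => Submodule.le_topologicalClosure _
      ⟨tensorInner p q x y, rightAlgebraHom_tensorInner α x y⟩)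
    (fun _ _ => add_mem) (fun c _ h => S.smul_mem c h) b

theorem isRightAssociatedNorm_associatedNorm :
    IsRightAssociatedNorm p q α (associatedNorm p q α) := by
  refine ⟨rightAlgebraHom p q α, fun e e' f f' => ?_, fun t => rfl,
    denseRange_rightAlgebraHom α⟩
  rw [← tensorInner_tmul, rightAlgebraHom_tensorInner]

/-- For any admissible `j`, `⟨x, y⟩ j(t) = j(⟨x, y⟩t) = j(⟨x, yt⟩) = ⟨x, yt⟩`, which does not depend
on `j`. Hence the difference of two such maps at `t` is annihilated from the left by a dense
subspace, thus by its own adjoint, and vanishes. -/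
theorem isRightAssociatedNorm_iff (γ : CStarNorm (B ⊗[ℂ] C)) :
    IsRightAssociatedNorm p q α γ ↔ γ = associatedNorm p q α := by
  refine ⟨?_, fun h => h ▸ isRightAssociatedNorm_associatedNorm α⟩
  rintro ⟨j, hj, hγ, -⟩
  have hj' : ∀ x y, j (tensorInner p q x y) =
      (rightPair α.Completion).inner (α.toCompletion x) (α.toCompletion y) := fun x y => by
    induction y with
    | zero => simp
    | add y y' hy hy' => simp only [map_add, hy, hy']
    | tmul f f' =>
      induction x with
      | zero => simp
      | add x x' hx hx' => simp only [map_add, LinearMap.add_apply, hx, hx']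
      | tmul e e' => rw [tensorInner_tmul, hj]
  have key : ∀ t, j t = rightAlgebraHom p q α t := fun t => by
    rw [← sub_eq_zero, ← CStarRing.star_mul_self_eq_zero_iff]
    refine rightAlgebra_completion_induction α
      (P := fun a => a * (j t - rightAlgebraHom p q α t) = 0)
      (isClosed_eq (continuous_mul_const _) continuous_const) (zero_mul _) (fun x y => ?_)
      (fun a b ha hb => by rw [add_mul, ha, hb, add_zero])
      (fun c a ha => by rw [smul_mul_assoc, ha, smul_zero]) _
    rw [mul_sub, sub_eq_zero]
    nth_rw 1 [← hj']
    rw [← rightAlgebraHom_tensorInner (p := p) (q := q), ← map_mul, ← map_mul,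
      ← tensorInner_tensorRep, hj', rightAlgebraHom_tensorInner]
  refine CStarNorm.coe_injective (funext fun t => ?_)
  change γ t = ‖rightAlgebraHom p q α t‖
  rw [← hγ, key]

end Tensor

/-! ### Iterated squares and elementary inequalities for `C*`-norms. -/

/-- For `A > 0`, iteration gives `(u 0 / A) ^ 2 ^ n ≤ u n / A ≤ (C / A) m ^ 2 ^ n`. Taking roots of
order `2 ^ n` removes `C`, so `u 0 / A ≤ m`. -/
theorem le_mul_of_sq_le_seq {u : ℕ → ℝ} {A C m : ℝ} (hA : 0 ≤ A) (hm : 0 ≤ m) (h0 : ∀ n, 0 ≤ u n)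
    (hu : ∀ n, u n ^ 2 ≤ u (n + 1) * A) (hC : ∀ n, u n ≤ C * m ^ 2 ^ n) : u 0 ≤ m * A := by
  rcases hA.eq_or_lt with rfl | hA
  · have := hu 0
    rw [mul_zero] at this
    rw [mul_zero]
    exact (pow_eq_zero_iff two_ne_zero).1 (le_antisymm this (sq_nonneg _)) |>.le
  by_contra! hlt
  have hpow : ∀ n, (u 0 / A) ^ 2 ^ n ≤ u n / A := fun n => by
    induction n with
    | zero => simp
    | succ n ih =>
      calc (u 0 / A) ^ 2 ^ (n + 1) = ((u 0 / A) ^ 2 ^ n) ^ 2 := by rw [pow_succ, pow_mul]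
        _ ≤ (u n / A) ^ 2 := pow_le_pow_left₀ (pow_nonneg (div_nonneg (h0 0) hA.le) _) ih 2
        _ ≤ u (n + 1) * A / A ^ 2 := by
          rw [div_pow]; exact div_le_div_of_nonneg_right (hu n) (sq_nonneg A)
        _ = u (n + 1) / A := by field_simp
  have hlt' : m < u 0 / A := (lt_div_iff₀ hA).2 hlt
  have hb : ∀ n, (u 0 / A) ^ 2 ^ n ≤ C / A * m ^ 2 ^ n := fun n =>
    (hpow n).trans ((div_le_div_of_nonneg_right (hC n) hA.le).trans_eq (by ring))
  rcases hm.eq_or_lt with rfl | hm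
  · have := hb 0
    simp only [pow_zero, pow_one, mul_zero] at this
    exact absurd hlt' (not_lt.2 this)
  · obtain ⟨n, hn⟩ := pow_unbounded_of_one_lt (C / A) ((one_lt_div hm).2 hlt')
    have h2 : (u 0 / A / m) ^ n ≤ (u 0 / A / m) ^ 2 ^ n :=
      pow_le_pow_right₀ ((one_lt_div hm).2 hlt').le n.lt_two_pow_self.le
    have h3 : (u 0 / A / m) ^ 2 ^ n ≤ C / A := by
      rw [div_pow, div_le_iff₀ (pow_pos hm _)]
      exact hb n
    linarith

section SquareSeq

variable {A : Type*} [NonUnitalRing A] [StarRing A]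

/-- The sequence `h ^ (2 ^ n)` of iterated squares. -/
def squareSeq (h : A) : ℕ → A
  | 0 => h
  | n + 1 => squareSeq h n * squareSeq h n

theorem star_squareSeq {h : A} (hh : star h = h) (n : ℕ) : star (squareSeq h n) = squareSeq h n := by
  induction n with
  | zero => exact hh
  | succ n ih => simp only [squareSeq, star_mul, ih]

end SquareSeq

namespace CStarNorm

variable {A : Type*} [NonUnitalRing A] [Module ℂ A] [StarRing A] (γ : CStarNorm A)

theorem nonneg (a : A) : 0 ≤ γ a := apply_nonneg γ.toSeminorm a

theorem map_le_map_star (a : A) : γ a ≤ γ (star a) := by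
  rcases (γ.nonneg a).eq_or_lt with h | h
  · rw [← h]; exact γ.nonneg _
  · refine le_of_mul_le_mul_right ?_ h
    rw [← sq, ← γ.map_star_mul_self]
    exact γ.map_mul_le _ _

theorem map_star (a : A) : γ (star a) = γ a :=
  le_antisymm (by simpa using γ.map_le_map_star (star a)) (γ.map_le_map_star a)

theorem map_self_mul_star (a : A) : γ (a * star a) = γ a ^ 2 := by
  have := γ.map_star_mul_self (star a)
  rwa [star_star, γ.map_star] at this

theorem map_squareSeq_le (h : A) (n : ℕ) : γ (squareSeq h n) ≤ γ h ^ 2 ^ n := by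
  induction n with
  | zero => simp [squareSeq]
  | succ n ih =>
    rw [pow_succ, pow_mul, sq]
    exact (γ.map_mul_le _ _).trans (mul_le_mul ih ih (γ.nonneg _) (pow_nonneg (γ.nonneg _) _))

theorem map_mul_star_mul_le (x y z : A) : γ (x * star y * z) ≤ γ x * γ y * γ z := by
  refine (γ.map_mul_le _ _).trans (mul_le_mul_of_nonneg_right ?_ (γ.nonneg z))
  exact (γ.map_mul_le _ _).trans_eq (by rw [γ.map_star])

/-- The lower bound comes from the `C*`-identity used twice: `γ(x)⁴ = γ((x* x)²) = γ(x* (x x* x))`.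
-/
theorem map_mul_star_mul_self (x : A) : γ (x * star x * x) = γ x ^ 3 := by
  refine le_antisymm ((γ.map_mul_star_mul_le x x x).trans_eq (by ring)) ?_
  rcases (γ.nonneg x).eq_or_lt with h | h
  · rw [← h]; simp
  · refine le_of_mul_le_mul_left ?_ h
    calc γ x * γ x ^ 3 = (γ x ^ 2) ^ 2 := by ring
      _ = γ (star x * (x * star x * x)) := by
        rw [← γ.map_star_mul_self x, ← γ.map_star_mul_self (star x * x)]
        simp only [star_mul, star_star, mul_assoc]
      _ ≤ γ x * γ (x * star x * x) := (γ.map_mul_le _ _).trans_eq (by rw [γ.map_star])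

end CStarNorm

/-! ### `C*`-algebras as ternary rings, and the embedding of `(B ⊙ C, γ)` in a `C*`-algebra. -/

section SelfTernary

open CStarTernaryRing

universe u v

/-- A `C*`-algebra as a `C*`-ternary ring, with the ternary product `x y* z`. -/
abbrev cstarAlgebraTernaryRing (B : Type*) [NonUnitalCStarAlgebra B] : CStarTernaryRing B where
  tern := LinearMap.mk₂'ₛₗ (RingHom.id ℂ) (starRingEnd ℂ)
    (fun x y => LinearMap.mulLeft ℂ (x * star y))
    (fun x x' y => by ext; simp [add_mul, mul_assoc])
    (fun c x y => by ext; simp [smul_mul_assoc, mul_assoc])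
    (fun x y y' => by ext; simp [mul_add, add_mul, mul_assoc])
    (fun c x y => by ext; simp [smul_mul_assoc, mul_smul_comm, mul_assoc])
  tern_tern_left x y z u v := by simp [mul_assoc]
  tern_tern_right x y z u v := by simp [mul_assoc]
  norm_tern_le x y z := by
    simp only [LinearMap.mk₂'ₛₗ_apply, LinearMap.mulLeft_apply]
    refine (norm_mul_le _ _).trans (mul_le_mul_of_nonneg_right ?_ (norm_nonneg z))
    exact (norm_mul_le _ _).trans_eq (by rw [norm_star])
  norm_tern_self x := by
    simp only [LinearMap.mk₂'ₛₗ_apply, LinearMap.mulLeft_apply]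
    let γ : CStarNorm B :=
      { toSeminorm := normSeminorm ℂ B
        eq_zero_of_map_eq_zero := fun _ => norm_eq_zero.1
        map_mul_le := norm_mul_le
        map_star_mul_self := fun a => CStarRing.norm_star_mul_self.trans (sq ‖a‖).symm }
    exact γ.map_mul_star_mul_self x

attribute [local instance] cstarAlgebraTernaryRing

variable {B : Type u} {C : Type v} [NonUnitalCStarAlgebra B] [NonUnitalCStarAlgebra C]

variable (B) in
/-- The right associated pair of a `C*`-algebra, with `⟨x, y⟩ = x* y`. -/
def selfPair : RightAssociatedPair B B where
  act := LinearMap.mul ℂ B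
  act_mul x b c := (mul_assoc x b c).symm
  norm_act_le := norm_mul_le
  inner := LinearMap.mk₂'ₛₗ (starRingEnd ℂ) (RingHom.id ℂ) (fun x y => star x * y)
    (fun x x' y => by simp [add_mul]) (fun c x y => by simp [smul_mul_assoc])
    (fun x y y' => by simp [mul_add]) (fun c x y => by simp [mul_smul_comm])
  norm_inner_le x y := (norm_mul_le _ _).trans_eq (by rw [norm_star])
  inner_act x y b := (mul_assoc _ _ _).symm
  star_inner x y := by simp
  tern_eq_act x y z := mul_assoc _ _ _
  dense_span := by
    let _ := CStarAlgebra.spectralOrder B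
    let _ := CStarAlgebra.spectralOrderedRing B
    have : (⊤ : Submodule ℂ B) ≤ Submodule.span ℂ {b | ∃ x y : B, b = star x * y} := by
      rw [← CStarAlgebra.span_nonneg]
      refine Submodule.span_mono fun a ha => ?_
      obtain ⟨c, hc⟩ := CStarAlgebra.nonneg_iff_eq_star_mul_self.1 (show (0 : B) ≤ a from ha)
      exact ⟨c, c, hc⟩
    exact fun b => subset_closure (this trivial)

theorem tern_tensor_eq_mul_star_mul (x y z : B ⊗[ℂ] C) : tern x y z = x * star y * z := by
  induction z with
  | zero => simp
  | add z z' hz hz' => simp only [map_add, mul_add, hz, hz']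
  | tmul z z' =>
    induction y with
    | zero => simp
    | add y y' hy hy' =>
      simp only [map_add, star_add, mul_add, add_mul, LinearMap.add_apply, hy, hy']
    | tmul y y' =>
      induction x with
      | zero => simp
      | add x x' hx hx' => simp only [map_add, add_mul, LinearMap.add_apply, hx, hx']
      | tmul x x' =>
        rw [tern_tmul, TensorProduct.star_tmul, Algebra.TensorProduct.tmul_mul_tmul,
          Algebra.TensorProduct.tmul_mul_tmul]
        rfl

/-- A `C*`-norm on `B ⊙ C`, as a `C*`-norm on a `*`-ternary ring. -/
def CStarNorm.toTernary (γ : CStarNorm (B ⊗[ℂ] C)) : TernaryCStarNorm (B ⊗[ℂ] C) where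
  toSeminorm := γ.toSeminorm
  eq_zero_of_map_eq_zero := γ.eq_zero_of_map_eq_zero
  map_tern_le x y z := by
    rw [tern_tensor_eq_mul_star_mul]
    exact γ.map_mul_star_mul_le x y z
  map_tern_self x := by
    rw [tern_tensor_eq_mul_star_mul]
    exact γ.map_mul_star_mul_self x

theorem tensorRep_selfPair (x t : B ⊗[ℂ] C) :
    (tensorRep (selfPair B) (selfPair C)).toLin t x = x * t := by
  induction t with
  | zero => simp
  | add t t' ht ht' => simp only [map_add, mul_add, LinearMap.add_apply, ht, ht']
  | tmul b c =>
    induction x with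
    | zero => simp
    | add x x' hx hx' => simp only [map_add, add_mul, hx, hx']
    | tmul x x' =>
      rw [Algebra.TensorProduct.tmul_mul_tmul]
      rfl

/-- The operator is right multiplication by `t` on `(B ⊙ C, γ)`; it attains its norm at `t*`,
because `γ(t* t) = γ(t*) γ(t)`. -/
theorem norm_tensorHom_selfPair (γ : CStarNorm (B ⊗[ℂ] C)) (t : B ⊗[ℂ] C) :
    ‖tensorHom (selfPair B) (selfPair C) γ.toTernary t‖ = γ t := by
  refine le_antisymm ?_ ?_
  · refine (isBounded_tensorRep _ _ γ.toTernary).norm_hom_le t (γ.nonneg t) fun x => ?_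
    rw [tensorRep_selfPair, mul_comm]
    exact γ.map_mul_le x t
  · rcases (γ.nonneg t).eq_or_lt with h | h
    · rw [← h]; exact norm_nonneg _
    · refine le_of_mul_le_mul_right ?_ h
      have := (isBounded_tensorRep (selfPair B) (selfPair C) γ.toTernary).map_le t (star t)
      rw [tensorRep_selfPair] at this
      calc γ t * γ t = γ (star t * t) := by rw [γ.map_star_mul_self, sq]
        _ ≤ _ := this
        _ = _ := congrArg _ (γ.map_star t)

/-- `B ⊙ C`, with a `C*`-norm, embeds isometrically in a `C*`-algebra. -/
theorem CStarNorm.exists_isometric_hom (γ : CStarNorm (B ⊗[ℂ] C)) :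
    ∃ (D : Type max u v) (_ : CStarAlgebra D) (j : B ⊗[ℂ] C →⋆ₙₐ[ℂ] D), ∀ t, ‖j t‖ = γ t :=
  ⟨_, inferInstance, tensorHom (selfPair B) (selfPair C) γ.toTernary, norm_tensorHom_selfPair γ⟩

theorem CStarNorm.map_tmul_le (γ : CStarNorm (B ⊗[ℂ] C)) (b : B) (c : C) :
    γ (b ⊗ₜ c) ≤ ‖b‖ * ‖c‖ := by
  rw [← norm_tensorHom_selfPair]
  exact norm_tensorHom_tmul_le _ b c

end SelfTernary

/-! ### Cauchy–Schwarz and the norm on `E ⊙ F` associated with `γ`. -/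

/-- The discriminant argument behind Cauchy–Schwarz. If `m > 0` bounds `‖X‖`, then `a* X a ≤ m a*
a`, and `t = m⁻¹` leaves `m⁻¹ a* a ≤ Y`. -/
theorem CStarAlgebra.norm_sq_le_of_forall_nonneg {D : Type*} [NonUnitalCStarAlgebra D]
    [PartialOrder D] [StarOrderedRing D] {a X Y : D} (hX : IsSelfAdjoint X)
    (h : ∀ t : ℝ, 0 ≤ t ^ 2 • (star a * X * a) - (2 * t) • (star a * a) + Y) :
    ‖a‖ ^ 2 ≤ ‖X‖ * ‖Y‖ := by
  have key : ∀ m : ℝ, 0 < m → ‖X‖ ≤ m → ‖a‖ ^ 2 ≤ m * ‖Y‖ := fun m hm hXm => by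
    have ha : 0 ≤ star a * a := star_mul_self_nonneg a
    have h1 : star a * X * a ≤ m • (star a * a) :=
      (star_left_conjugate_le_norm_smul hX).trans (smul_le_smul_of_nonneg_right hXm ha)
    have h2 : m⁻¹ • (star a * a) ≤ Y := by
      have h3 : (m⁻¹) ^ 2 • (star a * X * a) ≤ m⁻¹ • (star a * a) :=
        (smul_le_smul_of_nonneg_left h1 (sq_nonneg _)).trans_eq (by
          rw [smul_smul]; congr 1; field_simp)
      have h4 := h m⁻¹
      rw [sub_add_eq_add_sub, sub_nonneg] at h4
      have h5 := h4.trans (add_le_add_left h3 Y)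
      rw [two_mul, add_smul] at h5
      exact le_of_add_le_add_left h5
    have h3 : ‖m⁻¹ • (star a * a)‖ ≤ ‖Y‖ :=
      CStarAlgebra.norm_le_norm_of_nonneg_of_le (smul_nonneg (inv_nonneg.2 hm.le) ha) h2
    rw [norm_smul, CStarRing.norm_star_mul_self, Real.norm_of_nonneg (inv_nonneg.2 hm.le),
      inv_mul_le_iff₀ hm, ← sq] at h3
    exact h3
  refine le_of_forall_pos_le_add fun ε hε => ?_
  have hY : 0 < ‖Y‖ + 1 := by positivity
  -- The excess over `‖X‖` keeps `m` positive when `X = 0`, and costs at most `ε` after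
  -- multiplication by `‖Y‖`.
  refine (key (‖X‖ + ε / (‖Y‖ + 1)) (by positivity) (by simp; positivity)).trans ?_
  rw [add_mul]
  gcongr
  rw [div_mul_eq_mul_div, div_le_iff₀ hY]
  gcongr
  simp

section Tensor

open CStarTernaryRing

variable {E F : Type*} [NormedAddCommGroup E] [NormedSpace ℂ E] [CStarTernaryRing E]
  [NormedAddCommGroup F] [NormedSpace ℂ F] [CStarTernaryRing F]
  {B C : Type*} [NonUnitalCStarAlgebra B] [NonUnitalCStarAlgebra C]
  {p : RightAssociatedPair E B} {q : RightAssociatedPair F C}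

theorem tensorInner_tern (w x y z : E ⊗[ℂ] F) :
    tensorInner p q w (tern x y z) = tensorInner p q w x * tensorInner p q y z := by
  rw [← tensorRep_tensorInner (p := p) (q := q), tensorInner_tensorRep]

theorem tensorInner_tern_left (w x y z : E ⊗[ℂ] F) :
    tensorInner p q (tern x y z) w = tensorInner p q z y * tensorInner p q x w := by
  rw [← star_tensorInner, tensorInner_tern, star_mul, star_tensorInner, star_tensorInner]

theorem tensorInner_tensorRep_left (x y : E ⊗[ℂ] F) (t : B ⊗[ℂ] C) :
    tensorInner p q ((tensorRep p q).toLin t x) y = star t * tensorInner p q x y := by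
  rw [← star_tensorInner, tensorInner_tensorRep, star_mul, star_tensorInner]

/-- Write `x = ∑ eᵢ ⊙ fᵢ` and factor both Gram matrices as `c* c` and `d* d`. Expanding shows that
the squares of `s (k, l) = ∑ᵢ c k i ⊙ d l i` sum to `⟨x, x⟩`. -/
theorem exists_tensorInner_self_eq_sum (hE : p.IsPositive) (hF : q.IsPositive) (x : E ⊗[ℂ] F) :
    ∃ (n : ℕ) (s : Fin n → B ⊗[ℂ] C), tensorInner p q x x = ∑ k, star (s k) * s k := by
  obtain ⟨S, hS⟩ := TensorProduct.exists_finset x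
  rw [← Finset.sum_coe_sort] at hS
  obtain ⟨c, hc⟩ := hE.exists_gram_eq fun i : S => i.1.1
  obtain ⟨d, hd⟩ := hF.exists_gram_eq fun i : S => i.1.2
  let s : S × S → B ⊗[ℂ] C := fun k => ∑ i, c k.1 i ⊗ₜ d k.2 i
  suffices h : tensorInner p q x x = ∑ k, star (s k) * s k from
    ⟨_, s ∘ (Fintype.equivFin (S × S)).symm, h.trans
      ((Fintype.equivFin (S × S)).symm.sum_comp fun k => star (s k) * s k).symm⟩
  have h1 : tensorInner p q x x =
      ∑ i, ∑ j, ∑ k : S × S, (star (c k.1 i) * c k.1 j) ⊗ₜ[ℂ] (star (d k.2 i) * d k.2 j) := by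
    rw [hS]
    simp only [map_sum, LinearMap.sum_apply, tensorInner_tmul]
    rw [Finset.sum_comm]
    refine Finset.sum_congr rfl fun i _ => Finset.sum_congr rfl fun j _ => ?_
    rw [hc, hd, TensorProduct.sum_tmul]
    simp only [TensorProduct.tmul_sum, Fintype.sum_prod_type]
  have h2 : ∀ k, star (s k) * s k =
      ∑ i, ∑ j, (star (c k.1 i) * c k.1 j) ⊗ₜ[ℂ] (star (d k.2 i) * d k.2 j) := fun k => by
    simp only [s, star_sum, TensorProduct.star_tmul, Finset.sum_mul_sum,
      Algebra.TensorProduct.tmul_mul_tmul]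
  rw [h1]
  simp only [h2]
  symm
  rw [Finset.sum_comm]
  exact Finset.sum_congr rfl fun i _ => Finset.sum_comm

theorem sq_map_tensorInner_le (hE : p.IsPositive) (hF : q.IsPositive)
    (γ : CStarNorm (B ⊗[ℂ] C)) (x y : E ⊗[ℂ] F) :
    γ (tensorInner p q x y) ^ 2 ≤ γ (tensorInner p q x x) * γ (tensorInner p q y y) := by
  obtain ⟨D, _, j, hj⟩ := γ.exists_isometric_hom
  let _ := CStarAlgebra.spectralOrder D
  let _ := CStarAlgebra.spectralOrderedRing D
  have hpos : ∀ z, 0 ≤ j (tensorInner p q z z) := fun z => by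
    obtain ⟨n, s, hs⟩ := exists_tensorInner_self_eq_sum hE hF z
    rw [hs, map_sum]
    refine Finset.sum_nonneg fun k _ => ?_
    rw [map_mul, map_star]
    exact star_mul_self_nonneg _
  rw [← hj, ← hj, ← hj]
  refine CStarAlgebra.norm_sq_le_of_forall_nonneg (hpos x).isSelfAdjoint fun t => ?_
  -- As `μ(x, x, y) = x⟨x, y⟩`, this is positivity of `⟨z, z⟩` at `z = t x⟨x, y⟩ - y`, the vector
  -- used in the Cauchy–Schwarz inequality for Hilbert modules.
  have h := hpos ((t : ℂ) • tern x x y - y)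
  have h' : tensorInner p q ((t : ℂ) • tern x x y - y) ((t : ℂ) • tern x x y - y) =
      ((t ^ 2 : ℝ) : ℂ) • (star (tensorInner p q x y) * tensorInner p q x x * tensorInner p q x y)
      - ((2 * t : ℝ) : ℂ) • (star (tensorInner p q x y) * tensorInner p q x y)
      + tensorInner p q y y := by
    simp only [map_sub, LinearMap.sub_apply, map_smulₛₗ, LinearMap.smul_apply, tensorInner_tern,
      tensorInner_tern_left, star_tensorInner, Complex.conj_ofReal, RingHom.id_apply, smul_sub,
      mul_assoc, Complex.ofReal_mul, Complex.ofReal_pow, Complex.ofReal_ofNat]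
    module
  rw [h', map_add, map_sub, map_smul j, map_smul j, map_mul, map_mul, map_mul, map_star,
    Complex.coe_smul, Complex.coe_smul] at h
  exact h

/-- By Cauchy–Schwarz `⟨e ⊙ f, x⟩ = 0` for all `e`, `f`, and the maps `⟨e, ·⟩ ⊗ ⟨f, ·⟩` separate
points. -/
theorem eq_zero_of_map_tensorInner_self (hE : p.IsPositive) (hF : q.IsPositive)
    (γ : CStarNorm (B ⊗[ℂ] C)) (x : E ⊗[ℂ] F) (hx : γ (tensorInner p q x x) = 0) :
    x = 0 := by
  refine TensorProduct.eq_zero_of_map_eq_zero (fun e => p.inner e) (fun f => q.inner f)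
    p.eq_zero_of_inner_eq_zero q.eq_zero_of_inner_eq_zero x fun e f => ?_
  have h : tensorInner p q (e ⊗ₜ f) x = 0 := by
    refine γ.eq_zero_of_map_eq_zero _ ((pow_eq_zero_iff two_ne_zero).1
      (le_antisymm ?_ (sq_nonneg _)))
    have := sq_map_tensorInner_le hE hF γ (e ⊗ₜ f) x
    rwa [hx, mul_zero] at this
  exact h

theorem map_tensorInner_le (hE : p.IsPositive) (hF : q.IsPositive)
    (γ : CStarNorm (B ⊗[ℂ] C)) (x y : E ⊗[ℂ] F) : γ (tensorInner p q x y) ≤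
    √(γ (tensorInner p q x x)) * √(γ (tensorInner p q y y)) := by
  rw [← Real.sqrt_mul (γ.nonneg _)]
  exact Real.le_sqrt_of_sq_le (sq_map_tensorInner_le hE hF γ x y)

/-- The `C*`-norm on `E ⊙ F` associated with a `C*`-norm on `B ⊙ C`. -/
def ternaryNorm (hE : p.IsPositive) (hF : q.IsPositive) (γ : CStarNorm (B ⊗[ℂ] C)) :
    TernaryCStarNorm (E ⊗[ℂ] F) where
  toSeminorm := Seminorm.of (fun x => √(γ (tensorInner p q x x)))
    (fun x y => by
      refine Real.sqrt_le_iff.2 ⟨by positivity, ?_⟩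
      have h1 := map_tensorInner_le hE hF γ x y
      have h2 := map_tensorInner_le hE hF γ y x
      have h3 := Real.sq_sqrt (γ.nonneg (tensorInner p q x x))
      have h4 := Real.sq_sqrt (γ.nonneg (tensorInner p q y y))
      simp only [map_add (tensorInner p q), map_add (tensorInner p q _), LinearMap.add_apply]
      have h5 := map_add_le_add γ.toSeminorm (tensorInner p q x x + tensorInner p q x y)
        (tensorInner p q y x + tensorInner p q y y)
      have h6 := map_add_le_add γ.toSeminorm (tensorInner p q x x) (tensorInner p q x y)
      have h7 := map_add_le_add γ.toSeminorm (tensorInner p q y x) (tensorInner p q y y)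
      change γ _ ≤ γ _ + γ _ at h5 h6 h7
      nlinarith)
    (fun c x => by
      have : γ (tensorInner p q (c • x) (c • x)) = ‖c‖ ^ 2 * γ (tensorInner p q x x) := by
        rw [map_smul, map_smulₛₗ, LinearMap.smul_apply, smul_smul]
        refine (map_smul_eq_mul γ.toSeminorm _ _).trans ?_
        rw [norm_mul, RCLike.norm_conj, sq]
        rfl
      rw [this, Real.sqrt_mul (sq_nonneg _), Real.sqrt_sq (norm_nonneg c)])
  eq_zero_of_map_eq_zero x hx := eq_zero_of_map_tensorInner_self hE hF γ x
    ((Real.sqrt_eq_zero (γ.nonneg _)).1 hx)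
  map_tern_le x y z := by
    change √(γ _) ≤ √(γ _) * √(γ _) * √(γ _)
    refine Real.sqrt_le_iff.2 ⟨by positivity, ?_⟩
    rw [tensorInner_tern_left, tensorInner_tern, ← star_tensorInner y z]
    have h := sq_map_tensorInner_le hE hF γ y z
    calc γ (star (tensorInner p q y z) * (tensorInner p q x x * tensorInner p q y z))
        ≤ γ (tensorInner p q y z) * (γ (tensorInner p q x x) * γ (tensorInner p q y z)) := by
          refine (γ.map_mul_le _ _).trans ?_
          rw [γ.map_star]
          exact mul_le_mul_of_nonneg_left (γ.map_mul_le _ _) (γ.nonneg _)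
      _ = γ (tensorInner p q x x) * γ (tensorInner p q y z) ^ 2 := by ring
      _ ≤ γ (tensorInner p q x x) * (γ (tensorInner p q y y) * γ (tensorInner p q z z)) :=
          mul_le_mul_of_nonneg_left h (γ.nonneg _)
      _ = _ := by
          rw [mul_pow, mul_pow, Real.sq_sqrt (γ.nonneg _), Real.sq_sqrt (γ.nonneg _),
            Real.sq_sqrt (γ.nonneg _)]
          ring
  map_tern_self x := by
    change √(γ _) = √(γ _) ^ 3
    -- `⟨μ(x, x, x), μ(x, x, x)⟩` is the cube of the self-adjoint element `⟨x, x⟩`.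
    have h := γ.map_mul_star_mul_self (tensorInner p q x x)
    rw [star_tensorInner, mul_assoc] at h
    rw [tensorInner_tern_left, tensorInner_tern, h]
    refine Real.sqrt_eq_iff_mul_self_eq (pow_nonneg (γ.nonneg _) 3) (by positivity) |>.2 ?_
    rw [← mul_pow, Real.mul_self_sqrt (γ.nonneg _)]

theorem ternaryNorm_apply (hE : p.IsPositive) (hF : q.IsPositive)
    (γ : CStarNorm (B ⊗[ℂ] C)) (x : E ⊗[ℂ] F) :
    ternaryNorm hE hF γ x = √(γ (tensorInner p q x x)) := rfl

theorem monotone_ternaryNorm (hE : p.IsPositive) (hF : q.IsPositive) :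
    Monotone (ternaryNorm hE hF) := fun _ _ h x =>
  Real.sqrt_le_sqrt (h (tensorInner p q x x))

/-- The claim is `‖θ_{X, X}‖ = ‖X‖²` in the completion. The lower bound is obtained by applying
`θ_{X, X}` to `X`, since `‖μ(X, X, X)‖ = ‖X‖³`. -/
theorem ternaryNorm_associatedNorm (hE : p.IsPositive) (hF : q.IsPositive)
    (α : TernaryCStarNorm (E ⊗[ℂ] F)) :
    ternaryNorm hE hF (associatedNorm p q α) = α := by
  refine TernaryCStarNorm.coe_injective (funext fun x => ?_)
  change √‖tensorHom p q α (tensorInner p q x x)‖ = α x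
  rw [tensorHom_tensorInner, ← α.norm_toCompletion]
  set X := α.toCompletion x
  suffices h : ‖theta X X‖ = ‖X‖ ^ 2 by rw [h, Real.sqrt_sq (norm_nonneg X)]
  refine le_antisymm ((norm_thetaL_le X X).trans_eq (sq _).symm) ?_
  rcases (norm_nonneg X).eq_or_lt with h | h
  · rw [← h]; simp
  · refine le_of_mul_le_mul_right ?_ h
    calc ‖X‖ ^ 2 * ‖X‖ = ‖tern X X X‖ := by rw [norm_tern_self]; ring
      _ ≤ ‖theta X X‖ * ‖X‖ := (theta X X).1.unop.le_opNorm X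

theorem CStarNorm.le_of_map_self_mul_star_le {γ δ : CStarNorm (B ⊗[ℂ] C)}
    (h : ∀ t, γ (t * star t) ≤ δ (t * star t)) : γ ≤ δ := fun t => by
  have := h t
  rw [γ.map_self_mul_star, δ.map_self_mul_star] at this
  exact le_of_sq_le_sq this (δ.nonneg t)

/-- Operator norms for `α` and `β` cannot be compared directly. For `h = t t*` the numbers `α(x h ^
(2 ^ n))` satisfy the squaring recursion for `α`, while the operator norm for `β` controls their
growth. -/
theorem monotone_associatedNorm : Monotone (associatedNorm p q) := fun α β hαβ => by
  refine CStarNorm.le_of_map_self_mul_star_le fun t => ?_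
  have hh : star (t * star t) = t * star t := by rw [star_mul, star_star]
  set h := t * star t
  have hα : ∀ x, 0 ≤ α x := apply_nonneg α.toSeminorm
  have hβ : ∀ x, 0 ≤ β x := apply_nonneg β.toSeminorm
  refine (isBounded_tensorRep p q α).norm_hom_le h ((associatedNorm p q β).nonneg h) fun x => ?_
  -- Only here does `β` enter as a norm of vectors: `β x` is a constant that the roots remove.
  refine le_mul_of_sq_le_seq (u := fun n => α ((tensorRep p q).toLin (squareSeq h n) x))
    (C := β x) (hα x) ((associatedNorm p q β).nonneg h) (fun n => hα _) (fun n => ?_) fun n => ?_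
  · have := TernaryRep.map_sq_le (r := tensorRep p q) (α := α) (squareSeq h n) x
    rwa [star_squareSeq hh] at this
  · rw [mul_comm]
    exact ((hαβ _).trans ((isBounded_tensorRep p q β).map_le _ x)).trans
      (mul_le_mul_of_nonneg_right ((associatedNorm p q β).map_squareSeq_le h n) (hβ x))

theorem associatedNorm_ternaryNorm_le (hE : p.IsPositive) (hF : q.IsPositive)
    (γ : CStarNorm (B ⊗[ℂ] C)) : associatedNorm p q (ternaryNorm hE hF γ) ≤ γ := fun t => by
  refine (isBounded_tensorRep p q _).norm_hom_le t (γ.nonneg t) fun x => ?_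
  rw [ternaryNorm_apply, ternaryNorm_apply, tensorInner_tensorRep_left, tensorInner_tensorRep]
  refine Real.sqrt_le_iff.2 ⟨mul_nonneg (γ.nonneg t) (Real.sqrt_nonneg _), ?_⟩
  rw [mul_pow, Real.sq_sqrt (γ.nonneg _)]
  calc _ ≤ γ (star t) * (γ (tensorInner p q x x) * γ t) := (γ.map_mul_le _ _).trans
        (mul_le_mul_of_nonneg_left (γ.map_mul_le _ _) (γ.nonneg _))
    _ = _ := by rw [γ.map_star]; ring

/-- On generators, `γ(⟨x, y⟩t) = γ(⟨x, yt⟩)` and Cauchy–Schwarz applies. The constant `K` depends on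
the way `s` is written as a sum, which is harmless for the squaring argument. -/
theorem exists_map_mul_le (hE : p.IsPositive) (hF : q.IsPositive) (γ : CStarNorm (B ⊗[ℂ] C))
    {s : B ⊗[ℂ] C} (hs : s ∈ Submodule.span ℂ {b | ∃ x y, b = tensorInner p q x y}) :
    ∃ K, 0 ≤ K ∧ ∀ t, γ (s * t) ≤ K * associatedNorm p q (ternaryNorm hE hF γ) t := by
  induction hs using Submodule.span_induction with
  | mem s hs =>
    obtain ⟨x, y, rfl⟩ := hs
    refine ⟨ternaryNorm hE hF γ x * ternaryNorm hE hF γ y,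
      mul_nonneg (Real.sqrt_nonneg _) (Real.sqrt_nonneg _), fun t => ?_⟩
    rw [← tensorInner_tensorRep, mul_assoc]
    refine (map_tensorInner_le hE hF γ _ _).trans
      (mul_le_mul_of_nonneg_left ?_ (Real.sqrt_nonneg _))
    exact ((isBounded_tensorRep p q (ternaryNorm hE hF γ)).map_le t y).trans_eq (mul_comm _ _)
  | zero => exact ⟨0, le_rfl, fun t => by rw [zero_mul, zero_mul]; exact (map_zero γ.toSeminorm).le⟩
  | add a b _ _ ha hb =>
    obtain ⟨K, hK, h⟩ := ha
    obtain ⟨K', hK', h'⟩ := hb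
    refine ⟨K + K', add_nonneg hK hK', fun t => ?_⟩
    rw [add_mul, add_mul]
    exact (map_add_le_add γ.toSeminorm _ _).trans (add_le_add (h t) (h' t))
  | smul c a _ ha =>
    obtain ⟨K, hK, h⟩ := ha
    refine ⟨‖c‖ * K, mul_nonneg (norm_nonneg c) hK, fun t => ?_⟩
    rw [smul_mul_assoc, mul_assoc]
    exact (map_smul_eq_mul γ.toSeminorm _ _).le.trans
      (mul_le_mul_of_nonneg_left (h t) (norm_nonneg c))

/-- For `s` in the span of the inner products, squaring sharpens the crude bound to `γ(s h) ≤ δ(h)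
γ(s)`. This persists on the closure of the span, which contains `h` itself, and `s = h` gives `γ(h)²
≤ δ(h) γ(h)`. -/
theorem le_associatedNorm_ternaryNorm (hE : p.IsPositive) (hF : q.IsPositive)
    (γ : CStarNorm (B ⊗[ℂ] C)) : γ ≤ associatedNorm p q (ternaryNorm hE hF γ) := by
  refine CStarNorm.le_of_map_self_mul_star_le fun t => ?_
  have hh : star (t * star t) = t * star t := by rw [star_mul, star_star]
  set δ := associatedNorm p q (ternaryNorm hE hF γ)
  set h := t * star t
  have h1 : ∀ s ∈ Submodule.span ℂ {b | ∃ x y, b = tensorInner p q x y},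
      γ (s * h) ≤ δ h * γ s := fun s hs => by
    obtain ⟨K, hK, hs⟩ := exists_map_mul_le hE hF γ hs
    refine le_mul_of_sq_le_seq (u := fun n => γ (s * squareSeq h n)) (C := K) (γ.nonneg s)
      (δ.nonneg h) (fun n => γ.nonneg _) (fun n => ?_) fun n => ?_
    · rw [← γ.map_self_mul_star, star_mul, star_squareSeq hh, ← γ.map_star s]
      refine le_trans (le_of_eq ?_) (γ.map_mul_le _ _)
      simp only [squareSeq, mul_assoc]
    · exact (hs _).trans (mul_le_mul_of_nonneg_left (δ.map_squareSeq_le h n) hK)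
  obtain ⟨D, _, j, hj⟩ := γ.exists_isometric_hom
  -- The closure is taken in a `C*`-algebra `D` containing `(B ⊙ C, γ)`; as `γ` is bounded by `‖b‖
  -- ‖c‖` on `b ⊙ c`, it contains all of `B ⊙ C`.
  let S : Submodule ℂ D := ((Submodule.span ℂ {b | ∃ x y, b = tensorInner p q x y}).map
    (j : B ⊗[ℂ] C →ₗ[ℂ] D)).topologicalClosure
  have h2 : j h ∈ S := map_mem_of_isClosed (p := p) (q := q) (j : B ⊗[ℂ] C →ₗ[ℂ] D)
    (fun b c => (hj _).trans_le (γ.map_tmul_le b c)) S (Submodule.isClosed_topologicalClosure _)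
    (fun x y => Submodule.le_topologicalClosure _
      (Submodule.mem_map_of_mem (Submodule.subset_span ⟨x, y, rfl⟩))) h
  have h3 : ∀ d ∈ S, ‖d * j h‖ ≤ δ h * ‖d‖ := fun d hd => by
    refine closure_minimal (t := {d | ‖d * j h‖ ≤ δ h * ‖d‖}) ?_
      (isClosed_le (by fun_prop) (by fun_prop)) hd
    rintro _ ⟨s, hs, rfl⟩
    change ‖j s * j h‖ ≤ δ h * ‖j s‖
    rw [← map_mul, hj, hj]
    exact h1 s hs
  have h4 := h3 _ h2
  rw [← map_mul, hj, hj] at h4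
  nth_rw 1 [← hh] at h4
  rw [γ.map_star_mul_self, sq] at h4
  rcases (γ.nonneg h).eq_or_lt with h0 | h0
  · rw [← h0]; exact δ.nonneg h
  · exact le_of_mul_le_mul_right h4 h0

end Tensor

end

theorem mainTheorem4 {E F B_E B_F : Type*}
    [NormedAddCommGroup E] [NormedSpace ℂ E] [CStarTernaryRing E]
    [NormedAddCommGroup F] [NormedSpace ℂ F] [CStarTernaryRing F]
    [NonUnitalCStarAlgebra B_E] [NonUnitalCStarAlgebra B_F]
    (p : RightAssociatedPair E B_E) (q : RightAssociatedPair F B_F)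
    (hE : p.IsPositive) (hF : q.IsPositive) :
    ∃ (φ : CStarNorm (B_E ⊗[ℂ] B_F) → TernaryCStarNorm (E ⊗[ℂ] F))
      (ψ : TernaryCStarNorm (E ⊗[ℂ] F) → CStarNorm (B_E ⊗[ℂ] B_F)),
      (∀ γ x, φ γ x = √(γ (tensorInner p q x x))) ∧
      (∀ α γ, IsRightAssociatedNorm p q α γ ↔ γ = ψ α) ∧
      Function.LeftInverse ψ φ ∧ Function.RightInverse ψ φ ∧
      Monotone φ ∧ Monotone ψ :=
  ⟨ternaryNorm hE hF, associatedNorm p q, ternaryNorm_apply hE hF, isRightAssociatedNorm_iff,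
    fun γ => le_antisymm (associatedNorm_ternaryNorm_le hE hF γ)
      (le_associatedNorm_ternaryNorm hE hF γ),
    ternaryNorm_associatedNorm hE hF, monotone_ternaryNorm hE hF, monotone_associatedNorm⟩
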